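/- Let $H$ and $U$ be complex Hilbert spaces, let $A:\mathcal D(A)\subset H\to H$ be a self-adjoint, positive and invertible (bijective from $\mathcal D(A)$ onto $H$) operator, let $B\in\mathcal L(U,H)$, and let $\mu\in\mathbb R$, $T_0>0$, $\xi>0$ with $\xi\ge|\mu|T_0$. Put $H_1=\mathcal D(A)$ and $H_{1/2}=\mathcal D(A^{1/2})$ with norm $\|A^{1/2}\cdot\|_H$, and let $\mathcal H_g=H_{1/2}\times H\times L^2(0,1;U)$ with the inner product $$((u,v,z),(u_1,v_1,z_1))_{\mathcal H_g}=(A^{1/2}u,A^{1/2}u_1)_H+(v,v_1)_H+\xi\int_0^1(z,z_1)_U\,d\rho .$$ Let $\mathcal A_g$ be the operator $$\mathcal A_g(u,v,z)=\bigl(v,\,-Au-\mu Bz(1),\,-T_0^{-1}z_\rho\bigr),\qquad \mathcal D(\mathcal A_g)=\{(u,v,z)\in H_1\times H_{1/2}\times H^1(0,1;U): z(0)=B^*v\}.$$ Consider the delay system $$\ddot u(t)+Au(t)=0\ (0\le t\le T_0),\qquad \ddot u(t)+Au(t)+\mu BB^*\dot u(t-T_0)=0\ (t\ge T_0),\qquad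 u(0)=u_0,\ \dot u(0)=u_1 \tag{D}$$ and the Cauchy problem $$\dot X=\mathcal A_gX,\qquad X(0)=(u_0,u_1,0). \tag{C}$$ Then: 1. With $c=\left(\frac{|\mu|}{2}+\frac{\xi}{2T_0}\right)\|B^*\|^2_{\mathcal L(H,U)}$, the operator $\mathcal A_g-c\,\mathrm{Id}$ is maximal dissipative in $\mathcal H_g$, i.e. $\mathrm{Re}\,((\mathcal A_g-c)x,x)_{\mathcal H_g}\le 0$ for all $x\in\mathcal D(\mathcal A_g)$, and $\lambda\,\mathrm{Id}-(\mathcal A_g-c\,\mathrm{Id})$ maps $\mathcal D(\mathcal A_g)$ onto $\mathcal H_g$ for every $\lambda>0$. 2. For every $(u_0,u_1)\in H_{1/2}\times H$, problem (C) has a unique mild solution $X=(u,v,z)\in C([0,\infty),\mathcal H_g)$, that is, a unique continuous $X$ such that $\int_0^tX(s)\,ds\in\mathcal D(\mathcal A_g)$ and $X(t)=(u_0,u_1,0)+\mathcal A_g\int_0^tX(s)\,ds$ for all $t\ge0$. 3. If $(u_0,u_1,0)\in\mathcal D(\mathcal A_g)$, then this solution is classical: $X\in C([0,\infty),\mathcal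 D(\mathcal A_g))\cap C^1([0,\infty),\mathcal H_g)$ (with the graph norm on $\mathcal D(\mathcal A_g)$) and (C) holds for all $t\ge0$. Moreover $v=\dot u$; the function $u$ solves (D), and it is the only function in $C^2([0,\infty),H)$ with values in $\mathcal D(A)$ that solves (D); and for every $t\ge0$ and almost every $\rho\in(0,1)$, $z(\rho,t)=B^*\dot u(t-T_0\rho)$ if $T_0\rho\le t$ and $z(\rho,t)=0$ if $T_0\rho>t$. -/

import Mathlib

noncomputable section

open Set MeasureTheory
open scoped InnerProductSpace ContDiff

namespace DelayWave

/-- A (possibly unbounded) self-adjoint, positive and invertible operator on a complex Hilbert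
space `H`. Invertible means that it is a bijection from its domain onto `H`. Self-adjointness of a
`LinearPMap` includes the density of the domain. -/
structure PosInvOp (H : Type*) [NormedAddCommGroup H] [InnerProductSpace ℂ H]
    [CompleteSpace H] where
  /-- the operator, as a linear map on its domain -/
  op : H →ₗ.[ℂ] H
  isSelfAdjoint : IsSelfAdjoint op
  nonneg : ∀ x : op.domain, 0 ≤ (⟪(x : H), op x⟫_ℂ).re
  bijective : Function.Bijective op

section Sqrt

variable {H : Type*} [NormedAddCommGroup H] [InnerProductSpace ℂ H] [CompleteSpace H]

namespace PosInvOp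

variable (A : PosInvOp H)

/-- The linear bijection `A : D(A) → H`. -/
def equiv : A.op.domain ≃ₗ[ℂ] H := LinearEquiv.ofBijective A.op.toFun A.bijective

lemma op_symm (x y : A.op.domain) : ⟪A.op x, (y : H)⟫_ℂ = ⟪(x : H), A.op y⟫_ℂ := by
  have h := LinearPMap.adjoint_isFormalAdjoint A.isSelfAdjoint.dense_domain
  rw [LinearPMap.isSelfAdjoint_def.mp A.isSelfAdjoint] at h
  exact h x y

/-- `A⁻¹` as a linear map of `H`. -/
def invₗ : H →ₗ[ℂ] H := A.op.domain.subtype ∘ₗ A.equiv.symm.toLinearMap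

lemma op_equiv_symm (x : H) : A.op (A.equiv.symm x) = x := A.equiv.apply_symm_apply x

lemma invₗ_symm : A.invₗ.IsSymmetric := fun x y => by
  have h := A.op_symm (A.equiv.symm x) (A.equiv.symm y)
  rw [op_equiv_symm, op_equiv_symm] at h
  exact h.symm

/-- The bounded operator `A⁻¹` (everywhere defined and symmetric, hence continuous). -/
def inv : H →L[ℂ] H := ⟨A.invₗ, A.invₗ_symm.continuous⟩

lemma inv_apply (x : H) : A.inv x = (A.equiv.symm x : H) := rfl

lemma inv_nonneg : 0 ≤ A.inv := by
  rw [ContinuousLinearMap.nonneg_iff_isPositive]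
  refine ⟨A.invₗ_symm, fun x => ?_⟩
  have h := A.nonneg (A.equiv.symm x)
  rw [op_equiv_symm] at h
  exact h

/-- The bounded operator `A^{-1/2}`, the positive square root of `A⁻¹`. -/
def invSqrt : H →L[ℂ] H := CFC.sqrt A.inv

lemma invSqrt_invSqrt (x : H) : A.invSqrt (A.invSqrt x) = A.inv x := by
  have h := CFC.sqrt_mul_sqrt_self A.inv A.inv_nonneg
  exact congrArg (fun T : H →L[ℂ] H => T x) h

lemma invSqrt_injective : Function.Injective A.invSqrt := by
  rw [injective_iff_map_eq_zero]
  intro x hx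
  have h : A.inv x = 0 := by rw [← invSqrt_invSqrt, hx, map_zero]
  have h2 : A.equiv.symm x = 0 := Subtype.ext h
  simpa using h2

/-- The square root `A^{1/2}`, the inverse of `A^{-1/2}`; its domain is the range of
`A^{-1/2}`. -/
def sqrt : H →ₗ.[ℂ] H := (A.invSqrt.toLinearMap.toPMap ⊤).inverse

lemma sqrt_ker : LinearMap.ker (A.invSqrt.toLinearMap.toPMap ⊤).toFun = ⊥ := by
  rw [LinearMap.ker_eq_bot']
  intro x hx
  exact Subtype.ext ((injective_iff_map_eq_zero A.invSqrt).mp A.invSqrt_injective x hx)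

lemma mem_sqrt_domain {x : H} : x ∈ A.sqrt.domain ↔ ∃ y, A.invSqrt y = x := by
  rw [sqrt, LinearPMap.inverse_domain, LinearMap.mem_range]
  exact ⟨fun ⟨y, hy⟩ => ⟨y, hy⟩, fun ⟨y, hy⟩ => ⟨⟨y, trivial⟩, hy⟩⟩

lemma sqrt_invSqrt (y : H) : A.sqrt ⟨A.invSqrt y, A.mem_sqrt_domain.mpr ⟨y, rfl⟩⟩ = y :=
  LinearPMap.inverse_apply_eq A.sqrt_ker (x := ⟨y, trivial⟩) rfl

lemma invSqrt_sqrt (x : A.sqrt.domain) : A.invSqrt (A.sqrt x) = x := by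
  obtain ⟨x, hx⟩ := x
  obtain ⟨y, rfl⟩ := A.mem_sqrt_domain.mp hx
  rw [sqrt_invSqrt]

lemma sqrt_bijective : Function.Bijective A.sqrt.toFun :=
  ⟨fun x y h => Subtype.ext (by
      rw [← A.invSqrt_sqrt x, ← A.invSqrt_sqrt y]; exact congrArg A.invSqrt h),
    fun y => ⟨_, A.sqrt_invSqrt y⟩⟩

/-- The space `H_{1/2} = D(A^{1/2})`, with inner product `⟪A^{1/2} x, A^{1/2} y⟫`. -/
def Half : Type _ := A.sqrt.domain

instance : AddCommGroup A.Half := inferInstanceAs (AddCommGroup A.sqrt.domain)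

instance : Module ℂ A.Half := inferInstanceAs (Module ℂ A.sqrt.domain)

/-- The inclusion `H_{1/2} ⊆ H`. -/
def incl : A.Half →ₗ[ℂ] H := A.sqrt.domain.subtype

/-- `A^{1/2} : H_{1/2} → H`. -/
def sqrtHalf : A.Half →ₗ[ℂ] H := A.sqrt.toFun

instance : NormedAddCommGroup A.Half :=
  NormedAddCommGroup.induced A.Half H A.sqrtHalf A.sqrt_bijective.1

instance : InnerProductSpace ℂ A.Half where
  inner x y := ⟪A.sqrtHalf x, A.sqrtHalf y⟫_ℂ
  norm_smul_le c x := by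
    change ‖A.sqrtHalf (c • x)‖ ≤ ‖c‖ * ‖A.sqrtHalf x‖
    rw [map_smul, norm_smul]
  norm_sq_eq_re_inner x := norm_sq_eq_re_inner (𝕜 := ℂ) (A.sqrtHalf x)
  conj_inner_symm x y := inner_conj_symm (𝕜 := ℂ) (A.sqrtHalf x) (A.sqrtHalf y)
  add_left x y z := by
    change ⟪A.sqrtHalf (x + y), A.sqrtHalf z⟫_ℂ = _
    rw [map_add, inner_add_left]
  smul_left x y r := by
    change ⟪A.sqrtHalf (r • x), A.sqrtHalf y⟫_ℂ = _
    rw [map_smul, inner_smul_left]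

/-- `A^{1/2}` as an isometric isomorphism of `H_{1/2}` onto `H`. -/
def sqrtIso : A.Half ≃ₗᵢ[ℂ] H :=
  { LinearEquiv.ofBijective A.sqrtHalf A.sqrt_bijective with
    norm_map' := fun _ => rfl }

instance : CompleteSpace A.Half :=
  (completeSpace_congr (e := A.sqrtIso.toEquiv)
    A.sqrtIso.isometry.isUniformInducing.isUniformEmbedding).mpr inferInstance

end PosInvOp

end Sqrt

section Evolution

variable {E : Type*} [NormedAddCommGroup E] [InnerProductSpace ℂ E]

/-- `X ∈ C([0,∞), E)` is a mild solution of `X' = G X`, `X(0) = x₀`: for every `t ≥ 0`, the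
integral `∫₀ᵗ X` lies in `D(G)` and `X(t) = x₀ + G ∫₀ᵗ X`. Only the values of `X` on `[0,∞)`
matter. -/
def IsMildSolution (G : E →ₗ.[ℂ] E) (x₀ : E) (X : ℝ → E) : Prop :=
  ContinuousOn X (Ici 0) ∧
    ∀ t, 0 ≤ t → ∃ h : (∫ s in (0 : ℝ)..t, X s) ∈ G.domain,
      X t = x₀ + G ⟨∫ s in (0 : ℝ)..t, X s, h⟩

/-- `X ∈ C([0,∞), D(G)) ∩ C¹([0,∞), E)` (with the graph norm on `D(G)`; the derivative at `0` is
one-sided), `X' = G X` on `[0,∞)` and `X(0) = x₀`. Here `Y = G X = X'`. -/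
def IsClassicalSolution (G : E →ₗ.[ℂ] E) (x₀ : E) (X : ℝ → E) : Prop :=
  X 0 = x₀ ∧ ContinuousOn X (Ici 0) ∧
    ∃ Y : ℝ → E, ContinuousOn Y (Ici 0) ∧
      ∀ t, 0 ≤ t → (∃ h : X t ∈ G.domain, G ⟨X t, h⟩ = Y t) ∧
        HasDerivWithinAt X (Y t) (Ici 0) t

/-- `G - c Id` is maximal dissipative: `Re ⟪(G - c) x, x⟫ ≤ 0` on `D(G)`, and
`l Id - (G - c Id)` maps `D(G)` onto `E` for every `l > 0`. -/
def IsMaximalDissipativeShift (G : E →ₗ.[ℂ] E) (c : ℝ) : Prop :=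
  (∀ x : G.domain, (⟪(x : E), G x - c • (x : E)⟫_ℂ).re ≤ 0) ∧
    ∀ l : ℝ, 0 < l → ∀ y : E, ∃ x : G.domain, l • (x : E) - (G x - c • (x : E)) = y

end Evolution

section Generator

variable {H : Type*} [NormedAddCommGroup H] [InnerProductSpace ℂ H] [CompleteSpace H]
variable {U : Type*} [NormedAddCommGroup U] [InnerProductSpace ℂ U] [CompleteSpace U]

/-- `L²(0,1;U)` with the inner product `ξ ∫₀¹ ⟪z, z₁⟫ dρ`, obtained by weighting Lebesgue measure
on `(0,1)` by the constant `ξ`. -/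
abbrev L2 (U : Type*) [NormedAddCommGroup U] (ξ : ℝ) : Type _ :=
  Lp U 2 (ENNReal.ofReal ξ • (volume : Measure ℝ).restrict (Ioo 0 1))

/-- The space `H_{1/2} × H × L²(0,1;U)` with inner product
`⟪A^{1/2}u, A^{1/2}u₁⟫ + ⟪v, v₁⟫ + ξ ∫₀¹ ⟪z, z₁⟫ dρ`. -/
abbrev Hg (A : PosInvOp H) (U : Type*) [NormedAddCommGroup U] [InnerProductSpace ℂ U]
    (ξ : ℝ) : Type _ :=
  WithLp 2 (A.Half × WithLp 2 (H × L2 U ξ))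

namespace Hg

variable {A : PosInvOp H} {ξ : ℝ}

/-- The element `(u, v, z)`. -/
def mk (u : A.Half) (v : H) (z : L2 U ξ) : Hg A U ξ := WithLp.toLp 2 (u, WithLp.toLp 2 (v, z))

/-- First component. -/
def u (X : Hg A U ξ) : A.Half := X.fst

/-- Second component. -/
def v (X : Hg A U ξ) : H := X.snd.fst

/-- Third component. -/
def z (X : Hg A U ξ) : L2 U ξ := X.snd.snd

end Hg

/-- `w` is the weak derivative of `z` on `(0,1)`. -/
def IsWeakDeriv (z w : ℝ → U) : Prop :=
  ∀ φ : ℝ → ℝ, ContDiff ℝ ∞ φ → HasCompactSupport φ → tsupport φ ⊆ Ioo 0 1 →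
    ∫ ρ in Ioo (0 : ℝ) 1, deriv φ ρ • z ρ = - ∫ ρ in Ioo (0 : ℝ) 1, φ ρ • w ρ

/-- `zc` is the representative of `z` that is continuous on `[0,1]`; the traces of
`z ∈ H¹(0,1;U)` at `0` and `1` are `zc 0` and `zc 1`. -/
def IsContRepr (z zc : ℝ → U) : Prop :=
  ContinuousOn zc (Icc 0 1) ∧ z =ᵐ[volume.restrict (Ioo 0 1)] zc

/-- `x = (u, v, z) ∈ H_1 × H_{1/2} × H¹(0,1;U)`, `z(0) = B^* v`, and
`y = (v, -A u - μ B z(1), -T₀⁻¹ z_ρ)`. -/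
def GenRel (A : PosInvOp H) (B : U →L[ℂ] H) (μ T₀ ξ : ℝ) (x y : Hg A U ξ) : Prop :=
  ∃ (hu : A.incl x.u ∈ A.op.domain) (w : L2 U ξ) (zc : ℝ → U),
    IsWeakDeriv x.z w ∧ IsContRepr x.z zc ∧
    zc 0 = B.adjoint x.v ∧
    A.incl y.u = x.v ∧
    y.v = - A.op ⟨A.incl x.u, hu⟩ - μ • B (zc 1) ∧
    y.z = - (T₀⁻¹ • w)

section Facts

variable {A : PosInvOp H} {B : U →L[ℂ] H} {μ T₀ ξ : ℝ}

lemma absCont (hξ : 0 < ξ) : (volume : Measure ℝ).restrict (Ioo 0 1) ≪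
    ENNReal.ofReal ξ • (volume : Measure ℝ).restrict (Ioo 0 1) :=
  Measure.absolutelyContinuous_smul (by simpa using hξ)

lemma L2.integrableOn (hξ : 0 < ξ) (z : L2 U ξ) : IntegrableOn z (Ioo 0 1) := by
  have h1 : MemLp z 2 (volume.restrict (Ioo (0 : ℝ) 1)) := by
    have h := (Lp.memLp z).smul_measure (c := (ENNReal.ofReal ξ)⁻¹) (by simpa using hξ)
    rwa [smul_smul, ENNReal.inv_mul_cancel (by simpa using hξ) ENNReal.ofReal_ne_top,
      one_smul] at h
  exact h1.integrable (by norm_num)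

lemma integrable_test {φ : ℝ → ℝ} (h1 : Continuous φ) (h2 : HasCompactSupport φ) {z : ℝ → U}
    (hz : IntegrableOn z (Ioo 0 1)) : Integrable (fun ρ => φ ρ • z ρ)
      (volume.restrict (Ioo 0 1)) := by
  obtain ⟨C, hC⟩ := h2.exists_bound_of_continuous h1
  refine Integrable.mono' (hz.norm.const_mul C)
    (h1.aestronglyMeasurable.smul hz.aestronglyMeasurable)
    (Filter.Eventually.of_forall fun ρ => ?_)
  rw [norm_smul]
  exact mul_le_mul_of_nonneg_right (hC ρ) (norm_nonneg _)

lemma IsWeakDeriv.lin {z₁ w₁ z₂ w₂ z w : ℝ → U} (a b : ℂ)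
    (hz₁ : IntegrableOn z₁ (Ioo 0 1)) (hz₂ : IntegrableOn z₂ (Ioo 0 1))
    (hw₁ : IntegrableOn w₁ (Ioo 0 1)) (hw₂ : IntegrableOn w₂ (Ioo 0 1))
    (h₁ : IsWeakDeriv z₁ w₁) (h₂ : IsWeakDeriv z₂ w₂)
    (hz : z =ᵐ[volume.restrict (Ioo 0 1)] fun ρ => a • z₁ ρ + b • z₂ ρ)
    (hw : w =ᵐ[volume.restrict (Ioo 0 1)] fun ρ => a • w₁ ρ + b • w₂ ρ) :
    IsWeakDeriv z w := by
  intro φ h1 h2 h3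
  have key : ∀ (ψ : ℝ → ℝ) (f f₁ f₂ : ℝ → U), Continuous ψ → HasCompactSupport ψ →
      IntegrableOn f₁ (Ioo 0 1) → IntegrableOn f₂ (Ioo 0 1) →
      f =ᵐ[volume.restrict (Ioo 0 1)] (fun ρ => a • f₁ ρ + b • f₂ ρ) →
      ∫ ρ in Ioo (0 : ℝ) 1, ψ ρ • f ρ =
        a • (∫ ρ in Ioo (0 : ℝ) 1, ψ ρ • f₁ ρ) + b • ∫ ρ in Ioo (0 : ℝ) 1, ψ ρ • f₂ ρ := by
    intro ψ f f₁ f₂ hc hs hf₁ hf₂ hf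
    have i₁ : Integrable (fun ρ => a • (ψ ρ • f₁ ρ)) (volume.restrict (Ioo 0 1)) :=
      (integrable_test hc hs hf₁).smul a
    have i₂ : Integrable (fun ρ => b • (ψ ρ • f₂ ρ)) (volume.restrict (Ioo 0 1)) :=
      (integrable_test hc hs hf₂).smul b
    rw [← integral_smul, ← integral_smul, ← integral_add i₁ i₂]
    refine integral_congr_ae (hf.mono fun ρ hρ => ?_)
    simp only [hρ, smul_add, smul_comm (ψ ρ)]
  rw [key _ _ _ _ (h1.continuous_deriv (by simp)) h2.deriv hz₁ hz₂ hz,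
    key _ _ _ _ h1.continuous h2 hw₁ hw₂ hw, h₁ φ h1 h2 h3, h₂ φ h1 h2 h3]
  simp only [smul_neg, neg_add]

lemma IsContRepr.lin {z₁ c₁ z₂ c₂ z : ℝ → U} (a b : ℂ)
    (h₁ : IsContRepr z₁ c₁) (h₂ : IsContRepr z₂ c₂)
    (hz : z =ᵐ[volume.restrict (Ioo 0 1)] fun ρ => a • z₁ ρ + b • z₂ ρ) :
    IsContRepr z (fun ρ => a • c₁ ρ + b • c₂ ρ) := by
  refine ⟨(h₁.1.const_smul a).add (h₂.1.const_smul b), ?_⟩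
  filter_upwards [hz, h₁.2, h₂.2] with ρ h h1 h2
  rw [h, h1, h2]

lemma L2.coe_lin (hξ : 0 < ξ) (a b : ℂ) (z₁ z₂ : L2 U ξ) :
    (a • z₁ + b • z₂ : L2 U ξ) =ᵐ[volume.restrict (Ioo 0 1)]
      fun ρ => a • z₁ ρ + b • z₂ ρ := by
  have h : (a • z₁ + b • z₂ : L2 U ξ) =ᵐ[ENNReal.ofReal ξ • volume.restrict (Ioo 0 1)]
      fun ρ => a • z₁ ρ + b • z₂ ρ := by
    filter_upwards [Lp.coeFn_add (a • z₁) (b • z₂), Lp.coeFn_smul a z₁, Lp.coeFn_smul b z₂]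
      with ρ h1 h2 h3
    rw [h1, Pi.add_apply, h2, h3, Pi.smul_apply, Pi.smul_apply]
  exact (absCont hξ).ae_le h

lemma GenRel.lin (hξ : 0 < ξ) (a b : ℂ) {x₁ y₁ x₂ y₂ : Hg A U ξ}
    (h₁ : GenRel A B μ T₀ ξ x₁ y₁) (h₂ : GenRel A B μ T₀ ξ x₂ y₂) :
    GenRel A B μ T₀ ξ (a • x₁ + b • x₂) (a • y₁ + b • y₂) := by
  obtain ⟨hu₁, w₁, c₁, hw₁, hc₁, hb₁, e₁, f₁, g₁⟩ := h₁
  obtain ⟨hu₂, w₂, c₂, hw₂, hc₂, hb₂, e₂, f₂, g₂⟩ := h₂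
  have hu : A.incl (a • x₁ + b • x₂).u = a • A.incl x₁.u + b • A.incl x₂.u := by
    rw [← map_smul, ← map_smul, ← map_add]; rfl
  have hmem : A.incl (a • x₁ + b • x₂).u ∈ A.op.domain := by
    rw [hu]
    exact A.op.domain.add_mem (A.op.domain.smul_mem a hu₁) (A.op.domain.smul_mem b hu₂)
  have hop : A.op ⟨A.incl (a • x₁ + b • x₂).u, hmem⟩ =
      a • A.op ⟨A.incl x₁.u, hu₁⟩ + b • A.op ⟨A.incl x₂.u, hu₂⟩ := by
    rw [← LinearPMap.map_smul, ← LinearPMap.map_smul, ← LinearPMap.map_add]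
    exact congrArg A.op (Subtype.ext hu)
  refine ⟨hmem, a • w₁ + b • w₂, fun ρ => a • c₁ ρ + b • c₂ ρ, ?_, ?_, ?_, ?_, ?_, ?_⟩
  · exact IsWeakDeriv.lin a b (L2.integrableOn hξ _) (L2.integrableOn hξ _)
      (L2.integrableOn hξ _) (L2.integrableOn hξ _) hw₁ hw₂ (L2.coe_lin hξ a b _ _)
      (L2.coe_lin hξ a b _ _)
  · exact IsContRepr.lin a b hc₁ hc₂ (L2.coe_lin hξ a b _ _)
  · change a • c₁ 0 + b • c₂ 0 = B.adjoint (a • x₁.v + b • x₂.v)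
    rw [hb₁, hb₂, map_add, map_smul, map_smul]
  · change A.incl (a • y₁.u + b • y₂.u) = a • x₁.v + b • x₂.v
    rw [map_add, map_smul, map_smul, e₁, e₂]
  · change a • y₁.v + b • y₂.v = _
    rw [hop, f₁, f₂, map_add, map_smul, map_smul]
    simp only [smul_sub, smul_neg, smul_add, smul_comm μ]
    abel
  · change a • y₁.z + b • y₂.z = _
    rw [g₁, g₂]
    simp only [smul_neg, smul_add, smul_comm T₀⁻¹, neg_add]

lemma GenRel.zero (hξ : 0 < ξ) : GenRel A B μ T₀ ξ 0 0 := by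
  have hmem : A.incl (0 : Hg A U ξ).u ∈ A.op.domain := by
    change A.incl 0 ∈ _
    rw [map_zero]; exact A.op.domain.zero_mem
  have hop : A.op ⟨A.incl (0 : Hg A U ξ).u, hmem⟩ = 0 := by
    rw [← LinearPMap.map_zero A.op]
    exact congrArg A.op (Subtype.ext (map_zero A.incl))
  have hz : ((0 : L2 U ξ) : ℝ → U) =ᵐ[volume.restrict (Ioo 0 1)] 0 :=
    (absCont hξ).ae_le (Lp.coeFn_zero _ _ _)
  refine ⟨hmem, 0, 0, fun φ _ _ _ => ?_, ⟨continuousOn_const, hz⟩, ?_, ?_, ?_, ?_⟩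
  · have e : ∀ ψ : ℝ → ℝ, ∫ ρ in Ioo (0 : ℝ) 1, ψ ρ • (0 : L2 U ξ) ρ = 0 := fun ψ => by
      refine integral_eq_zero_of_ae (hz.mono fun ρ hρ => ?_)
      change ψ ρ • (0 : L2 U ξ) ρ = 0
      rw [hρ]; simp
    change ∫ ρ in Ioo (0 : ℝ) 1, deriv φ ρ • (0 : L2 U ξ) ρ = _
    rw [e, e, neg_zero]
  · change (0 : U) = B.adjoint 0
    rw [map_zero]
  · exact map_zero A.incl
  · rw [hop]
    change (0 : H) = - 0 - μ • B 0
    simp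
  · change (0 : L2 U ξ) = _
    simp

lemma GenRel.eq_zero (hξ : 0 < ξ) {y : Hg A U ξ} (h : GenRel A B μ T₀ ξ 0 y) : y = 0 := by
  obtain ⟨hmem, w, c, hw, hc, hb, e, f, g⟩ := h
  have hop : A.op ⟨A.incl (0 : Hg A U ξ).u, hmem⟩ = 0 := by
    rw [← LinearPMap.map_zero A.op]
    exact congrArg A.op (Subtype.ext (map_zero A.incl))
  have hz : ((0 : L2 U ξ) : ℝ → U) =ᵐ[volume.restrict (Ioo 0 1)] 0 :=
    (absCont hξ).ae_le (Lp.coeFn_zero _ _ _)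
  have hu : y.u = 0 := by
    refine Subtype.ext ?_
    exact e
  have hc1 : c 1 = 0 := by
    have h0 : c =ᵐ[volume.restrict (Icc (0 : ℝ) 1)] fun _ => (0 : U) := by
      rw [← restrict_Ioo_eq_restrict_Icc]
      exact hc.2.symm.trans hz
    exact Measure.eqOn_Icc_of_ae_eq volume zero_ne_one h0 hc.1 continuousOn_const
      (right_mem_Icc.mpr zero_le_one)
  have hw0 : w = 0 := by
    have h1 : ∀ᵐ ρ, ρ ∈ Ioo (0 : ℝ) 1 → w ρ = 0 := by
      refine isOpen_Ioo.ae_eq_zero_of_integral_contDiff_smul_eq_zero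
        (L2.integrableOn hξ w).locallyIntegrableOn fun φ h1 h2 h3 => ?_
      have h4 := hw φ h1 h2 h3
      have h5 : ∫ ρ in Ioo (0 : ℝ) 1, deriv φ ρ • (0 : Hg A U ξ).z ρ = 0 :=
        integral_eq_zero_of_ae (hz.mono fun ρ hρ => by
          change deriv φ ρ • (0 : L2 U ξ) ρ = 0
          rw [hρ]; simp)
      rw [h5, zero_eq_neg] at h4
      rw [← h4, setIntegral_eq_integral_of_forall_compl_eq_zero]
      intro ρ hρ
      rw [image_eq_zero_of_notMem_tsupport fun h => hρ (h3 h), zero_smul]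
    rw [Lp.eq_zero_iff_ae_eq_zero]
    exact Measure.smul_absolutelyContinuous.ae_le ((ae_restrict_iff' measurableSet_Ioo).mpr h1)
  have hv : y.v = 0 := by rw [f, hop, hc1]; simp
  have hz' : y.z = 0 := by rw [g, hw0]; simp
  change Hg.mk y.u y.v y.z = Hg.mk 0 0 0
  rw [hu, hv, hz']

end Facts

/-- The graph of `A_g`. -/
def genGraph (A : PosInvOp H) (B : U →L[ℂ] H) (μ T₀ : ℝ) {ξ : ℝ} (hξ : 0 < ξ) :
    Submodule ℂ (Hg A U ξ × Hg A U ξ) where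
  carrier := {p | GenRel A B μ T₀ ξ p.1 p.2}
  zero_mem' := GenRel.zero hξ
  add_mem' {p q} hp hq := by simpa using GenRel.lin hξ 1 1 hp hq
  smul_mem' a p hp := by simpa using GenRel.lin hξ a 0 hp (GenRel.zero hξ)

/-- The operator `A_g (u, v, z) = (v, -A u - μ B z(1), -T₀⁻¹ z_ρ)` in `Hg`, with domain
`{(u, v, z) ∈ H_1 × H_{1/2} × H¹(0,1;U) : B^* v = z(0)}`. -/
def Ag (A : PosInvOp H) (B : U →L[ℂ] H) (μ T₀ : ℝ) {ξ : ℝ} (hξ : 0 < ξ) :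
    Hg A U ξ →ₗ.[ℂ] Hg A U ξ :=
  (genGraph A B μ T₀ hξ).toLinearPMap

lemma mem_Ag_graph {A : PosInvOp H} {B : U →L[ℂ] H} {μ T₀ ξ : ℝ} (hξ : 0 < ξ)
    {x y : Hg A U ξ} : (x, y) ∈ (Ag A B μ T₀ hξ).graph ↔ GenRel A B μ T₀ ξ x y := by
  rw [Ag, Submodule.toLinearPMap_graph_eq]
  · exact Iff.rfl
  · rintro ⟨x, y⟩ hp rfl
    exact GenRel.eq_zero hξ hp

/-- `u : [0,∞) → H` is a twice continuously differentiable solution, with `u̇ = v`, of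
`ü + A u = 0` on `[0, T₀]`, `ü(t) + A u(t) + μ B B^* u̇(t - T₀) = 0` for `t ≥ T₀`, `u(0) = u₀`,
`u̇(0) = u₁`. -/
def IsDelaySolution (A : PosInvOp H) (B : U →L[ℂ] H) (μ T₀ : ℝ) (u₀ u₁ : H) (u v : ℝ → H) :
    Prop :=
  u 0 = u₀ ∧ v 0 = u₁ ∧ (∀ t, 0 ≤ t → HasDerivWithinAt u (v t) (Ici 0) t) ∧
    ∃ a : ℝ → H, ContinuousOn a (Ici 0) ∧ (∀ t, 0 ≤ t → HasDerivWithinAt v (a t) (Ici 0) t) ∧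
      ∀ t, 0 ≤ t → ∃ h : u t ∈ A.op.domain,
        (t ≤ T₀ → a t + A.op ⟨u t, h⟩ = 0) ∧
        (T₀ ≤ t → a t + A.op ⟨u t, h⟩ + μ • B (B.adjoint (v (t - T₀))) = 0)

end Generator

end DelayWave

end

/-!
The energy identity for `A_g` contains only the boundary terms `B^* v = z(0)` and `z(1)` of the
history. Young's inequality on the coupling `μ (B^* v, z(1))` together with `ξ ≥ |μ| T₀` leaves
`z(1)` with a nonpositive coefficient, so `A_g - c` is dissipative. It is maximal because solving
the transport equation and eliminating `v` turns the resolvent equation for `A_g` at `l` into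
`A u + l² u + l μ e^{-l T₀} B B^* u = r`, a perturbation of `A` by a bounded operator which is
positive as soon as `l ≥ c`.

For a maximal dissipative shift, the exponentials of the Yosida approximations converge locally
uniformly to mild solutions. If `x₀ ∈ D(G)`, then the mild solution `Y` starting at `G x₀` yields
the classical solution `t ↦ x₀ + ∫₀ᵗ Y`.

Two solutions of the transport equation with the same inflow differ by a function of nonincreasing
norm, so `z(t)` is the history of `B^* v`. Solutions of the delay system agree on
successive intervals of length `T₀`: there the delayed terms coincide, and the difference solves the
free wave equation, whose weak energy `‖A^{-1/2} v‖² + ‖u‖²` is conserved.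
-/

noncomputable section

open Set MeasureTheory Filter Topology
open scoped InnerProductSpace ContDiff

namespace DelayWave

section Calculus

variable {F : Type*} [NormedAddCommGroup F]

lemma intervalIntegrable_of_continuousOn_Ici {f : ℝ → F} (hf : ContinuousOn f (Ici 0)) {a b : ℝ}
    (ha : 0 ≤ a) (hb : 0 ≤ b) : IntervalIntegrable f volume a b :=
  (hf.mono fun _ hx => (le_min ha hb).trans hx.1).intervalIntegrable

lemma uniformCauchySeqOn_apply_of_dense {𝕜 α : Type*} [NontriviallyNormedField 𝕜]
    [NormedSpace 𝕜 F] {S : ℕ → α → F →L[𝕜] F} {D : Set F} (hD : Dense D) {s : Set α} {M : ℝ}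
    (hM : ∀ n, ∀ t ∈ s, ‖S n t‖ ≤ M)
    (h : ∀ x ∈ D, UniformCauchySeqOn (fun n t => S n t x) atTop s) (x : F) :
    UniformCauchySeqOn (fun n t => S n t x) atTop s := by
  rw [Metric.uniformCauchySeqOn_iff]
  intro ε hε
  obtain ⟨y, hyD, hy⟩ := hD.exists_dist_lt x (ε := ε / (3 * (|M| + 1))) (by positivity)
  have hclose : ∀ n, ∀ t ∈ s, dist (S n t x) (S n t y) < ε / 3 := fun n t ht => by
    rw [lt_div_iff₀ (by positivity)] at hy
    calc dist (S n t x) (S n t y) ≤ M * dist x y := by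
          simpa only [dist_eq_norm, map_sub] using (S n t).le_of_opNorm_le (hM n t ht) (x - y)
      _ ≤ (|M| + 1) * dist x y := by
          gcongr
          linarith [le_abs_self M]
      _ < ε / 3 := by linarith
  obtain ⟨N, hN⟩ := Metric.uniformCauchySeqOn_iff.mp (h y hyD) (ε / 3) (by positivity)
  refine ⟨N, fun m hm n hn t ht => ?_⟩
  calc dist (S m t x) (S n t x)
      ≤ dist (S m t x) (S m t y) + dist (S m t y) (S n t y) + dist (S n t y) (S n t x) :=
        dist_triangle4 ..
    _ < ε / 3 + ε / 3 + ε / 3 := by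
        gcongr
        exacts [hclose m t ht, hN m hm n hn t ht, dist_comm (S n t x) _ ▸ hclose n t ht]
    _ = ε := by ring

variable [NormedSpace ℝ F]

lemma hasDerivWithinAt_integral_Ici [CompleteSpace F] {f : ℝ → F} (hf : ContinuousOn f (Ici 0))
    {t : ℝ} (ht : 0 ≤ t) :
    HasDerivWithinAt (fun t => ∫ s in (0 : ℝ)..t, f s) (f t) (Ici 0) t := by
  have hext : Continuous fun s => f (max s 0) :=
    hf.comp_continuous (by fun_prop) fun s => le_max_right s 0
  have hderiv := (hext.integral_hasStrictDerivAt 0 t).hasDerivAt.hasDerivWithinAt (s := Ici 0)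
  rw [max_eq_left ht] at hderiv
  have heq : ∀ x ∈ Ici (0 : ℝ), (∫ s in (0 : ℝ)..x, f s) = ∫ s in (0 : ℝ)..x, f (max s 0) := by
    intro x hx
    refine intervalIntegral.integral_congr fun s hs => ?_
    rw [uIcc_of_le hx] at hs
    simp only [max_eq_left hs.1]
  exact hderiv.congr heq (heq t ht)

lemma exists_continuousOn_limit_of_uniformCauchySeqOn [CompleteSpace F] {X : ℕ → ℝ → F}
    (hX : ∀ n, ContinuousOn (X n) (Ici 0)) (h : ∀ T, UniformCauchySeqOn X atTop (Icc 0 T)) :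
    ∃ Y : ℝ → F, ContinuousOn Y (Ici 0) ∧ ∀ t, 0 ≤ t →
      Tendsto (fun n => X n t) atTop (𝓝 (Y t)) ∧
      Tendsto (fun n => ∫ s in (0 : ℝ)..t, X n s) atTop (𝓝 (∫ s in (0 : ℝ)..t, Y s)) := by
  have hlim : ∀ t : ℝ, ∃ y, 0 ≤ t → Tendsto (fun n => X n t) atTop (𝓝 y) := fun t => by
    by_cases ht : 0 ≤ t
    · obtain ⟨y, hy⟩ := cauchySeq_tendsto_of_complete ((h t).cauchySeq (right_mem_Icc.mpr ht))
      exact ⟨y, fun _ => hy⟩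
    · exact ⟨0, fun h => absurd h ht⟩
  choose Y hY using hlim
  have hunif : ∀ T, TendstoUniformlyOn X Y atTop (Icc 0 T) := fun T =>
    (h T).tendstoUniformlyOn_of_tendsto fun t ht => hY t ht.1
  refine ⟨Y, fun t ht => ?_, fun t ht => ⟨hY t ht, ?_⟩⟩
  · have hcont : ContinuousOn Y (Icc 0 (t + 1)) :=
      (hunif _).continuousOn (Frequently.of_forall fun n => (hX n).mono Icc_subset_Ici_self)
    refine (hcont t ⟨ht, by linarith⟩).mono_of_mem_nhdsWithin ?_
    rw [← Ici_inter_Iic]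
    exact inter_mem_nhdsWithin _ (Iic_mem_nhds (by linarith))
  · refine TendstoUniformlyOn.tendsto_intervalIntegral_of_continuousOn
      (Eventually.of_forall fun n => ?_) ?_
    · rw [uIcc_of_le ht]; exact (hX n).mono Icc_subset_Ici_self
    · rw [uIcc_of_le ht]; exact hunif t

end Calculus

section NormGronwall

variable {E : Type*} [NormedAddCommGroup E] [InnerProductSpace ℂ E]

lemma re_inner_self_smul (c : ℝ) (x : E) : (⟪x, c • x⟫_ℂ).re = c * ‖x‖ ^ 2 := by
  rw [inner_smul_right_eq_smul, Complex.smul_re, smul_eq_mul]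
  exact congrArg (c * ·) (inner_self_eq_norm_sq (𝕜 := ℂ) x)

lemma hasDerivWithinAt_norm_sq {f : ℝ → E} {f' : E} {s : Set ℝ} {t : ℝ}
    (hf : HasDerivWithinAt f f' s t) :
    HasDerivWithinAt (fun t => ‖f t‖ ^ 2) (2 * (⟪f t, f'⟫_ℂ).re) s t := by
  let : InnerProductSpace ℝ E := InnerProductSpace.rclikeToReal ℂ E
  exact hf.norm_sq

lemma norm_sq_le_gronwallBound {f f' : ℝ → E} {a b c ε : ℝ}
    (hf : ∀ t ∈ Icc a b, HasDerivWithinAt f (f' t) (Icc a b) t)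
    (hle : ∀ t ∈ Icc a b, (⟪f t, f' t⟫_ℂ).re ≤ c * ‖f t‖ ^ 2 + ε) {t : ℝ} (ht : t ∈ Icc a b) :
    ‖f t‖ ^ 2 ≤ gronwallBound (‖f a‖ ^ 2) (2 * c) (2 * ε) (t - a) := by
  have hsq : ∀ s ∈ Icc a b, HasDerivWithinAt (fun s => ‖f s‖ ^ 2) (2 * (⟪f s, f' s⟫_ℂ).re)
      (Icc a b) s := fun s hs => hasDerivWithinAt_norm_sq (hf s hs)
  refine le_gronwallBound_of_liminf_deriv_right_le (f' := fun s => 2 * (⟪f s, f' s⟫_ℂ).re)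
    (fun s hs => (hsq s hs).continuousWithinAt) (fun s hs r hr => ?_) le_rfl (fun s hs => ?_) t ht
  · exact ((hsq s (Ico_subset_Icc_self hs)).mono_of_mem_nhdsWithin
      (Icc_mem_nhdsGE_of_mem hs)).liminf_right_slope_le hr
  · linarith [hle s (Ico_subset_Icc_self hs)]

lemma norm_le_exp_mul_of_re_inner_deriv_le {f f' : ℝ → E} {c : ℝ}
    (hf : ∀ t, 0 ≤ t → HasDerivWithinAt f (f' t) (Ici 0) t)
    (hle : ∀ t, 0 ≤ t → (⟪f t, f' t⟫_ℂ).re ≤ c * ‖f t‖ ^ 2) {t : ℝ} (ht : 0 ≤ t) :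
    ‖f t‖ ≤ Real.exp (c * t) * ‖f 0‖ := by
  have hsq := norm_sq_le_gronwallBound (ε := 0)
    (fun s hs => (hf s hs.1).mono Icc_subset_Ici_self) (fun s hs => by simpa using hle s hs.1)
    (right_mem_Icc.mpr ht)
  refine le_of_sq_le_sq (hsq.trans_eq ?_) (by positivity)
  rw [mul_zero, gronwallBound_ε0, mul_pow, ← Real.exp_nat_mul, sub_zero, mul_comm, mul_assoc]
  norm_num

end NormGronwall

section Evolution

variable {E : Type*} [NormedAddCommGroup E] [InnerProductSpace ℂ E] {G : E →ₗ.[ℂ] E} {c : ℝ}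

lemma mem_graph_iff_exists_mem_domain {x y : E} :
    (x, y) ∈ G.graph ↔ ∃ h : x ∈ G.domain, G ⟨x, h⟩ = y := by
  rw [LinearPMap.mem_graph_iff]
  constructor
  · rintro ⟨z, rfl, rfl⟩
    exact ⟨z.2, rfl⟩
  · rintro ⟨h, rfl⟩
    exact ⟨⟨x, h⟩, rfl, rfl⟩

lemma isMildSolution_iff_mem_graph {x₀ : E} {X : ℝ → E} :
    IsMildSolution G x₀ X ↔ ContinuousOn X (Ici 0) ∧
      ∀ t, 0 ≤ t → ((∫ s in (0 : ℝ)..t, X s), X t - x₀) ∈ G.graph := by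
  refine and_congr_right fun _ => forall₂_congr fun t ht => ?_
  rw [mem_graph_iff_exists_mem_domain]
  refine exists_congr fun h => ?_
  rw [eq_sub_iff_add_eq', eq_comm]

lemma isMaximalDissipativeShift_of_graph
    (hdiss : ∀ x y, (x, y) ∈ G.graph → (⟪x, y⟫_ℂ).re ≤ c * ‖x‖ ^ 2)
    (hrange : ∀ l : ℝ, 0 < l → ∀ f, ∃ x, (x, (l + c) • x - f) ∈ G.graph) :
    IsMaximalDissipativeShift G c := by
  refine ⟨fun x => ?_, fun l hl f => ?_⟩
  · rw [inner_sub_right, Complex.sub_re, re_inner_self_smul]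
    linarith [hdiss _ _ (G.mem_graph x)]
  · obtain ⟨x, hx⟩ := hrange l hl f
    obtain ⟨hxD, hGx⟩ := mem_graph_iff_exists_mem_domain.mp hx
    refine ⟨⟨x, hxD⟩, ?_⟩
    rw [hGx, add_smul]
    abel

namespace IsMaximalDissipativeShift

lemma re_inner_le (hG : IsMaximalDissipativeShift G c) {x y : E} (h : (x, y) ∈ G.graph) :
    (⟪x, y⟫_ℂ).re ≤ c * ‖x‖ ^ 2 := by
  obtain ⟨z, rfl, rfl⟩ := (LinearPMap.mem_graph_iff G).mp h
  have hz := hG.1 z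
  rw [inner_sub_right, Complex.sub_re, re_inner_self_smul] at hz
  linarith

lemma re_inner_nonpos (hG : IsMaximalDissipativeShift G c) {x y : E}
    (h : (x, y + c • x) ∈ G.graph) : (⟪x, y⟫_ℂ).re ≤ 0 := by
  have hle := hG.re_inner_le h
  rw [inner_add_right, Complex.add_re, re_inner_self_smul] at hle
  linarith

lemma mul_norm_le (hG : IsMaximalDissipativeShift G c) {l : ℝ} (x : G.domain) :
    l * ‖(x : E)‖ ≤ ‖l • (x : E) - (G x - c • (x : E))‖ := by
  set y := l • (x : E) - (G x - c • (x : E)) with hy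
  have hmul : l * ‖(x : E)‖ ^ 2 ≤ ‖(x : E)‖ * ‖y‖ := by
    have hinner : (⟪(x : E), y⟫_ℂ).re ≤ ‖(x : E)‖ * ‖y‖ := re_inner_le_norm (𝕜 := ℂ) _ _
    rw [hy, inner_sub_right, Complex.sub_re, re_inner_self_smul] at hinner
    linarith [hG.1 x]
  rcases (norm_nonneg (x : E)).eq_or_lt with hx | hx
  · rw [← hx, mul_zero]
    exact norm_nonneg y
  · nlinarith

/-- The bijection `l - (G - c) : D(G) → E`, for `l > 0`. -/
def shiftEquiv (hG : IsMaximalDissipativeShift G c) {l : ℝ} (hl : 0 < l) : G.domain ≃ₗ[ℂ] E :=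
  LinearEquiv.ofBijective (l • G.domain.subtype - (G.toFun - c • G.domain.subtype))
    ⟨(injective_iff_map_eq_zero _).mpr fun x hx => by
        have hle : l * ‖(x : E)‖ ≤ ‖(0 : E)‖ := hx ▸ hG.mul_norm_le x
        rw [norm_zero] at hle
        exact Subtype.ext (norm_le_zero_iff.mp (nonpos_of_mul_nonpos_right hle hl)),
      hG.2 l hl⟩

variable (hG : IsMaximalDissipativeShift G c) {l : ℝ} (hl : 0 < l)

lemma shiftEquiv_apply (x : G.domain) :
    hG.shiftEquiv hl x = l • (x : E) - (G x - c • (x : E)) := rfl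

/-- The resolvent `(l - (G - c))⁻¹`, for `l > 0`. -/
def resolvent : E →L[ℂ] E :=
  LinearMap.mkContinuous (G.domain.subtype ∘ₗ (hG.shiftEquiv hl).symm.toLinearMap) l⁻¹ fun y => by
    rw [inv_mul_eq_div, le_div_iff₀' hl]
    have hle := hG.mul_norm_le (l := l) ((hG.shiftEquiv hl).symm y)
    rwa [← shiftEquiv_apply hG hl, LinearEquiv.apply_symm_apply] at hle

lemma resolvent_apply (y : E) : hG.resolvent hl y = (hG.shiftEquiv hl).symm y := rfl

lemma norm_resolvent_apply_le (y : E) : ‖hG.resolvent hl y‖ ≤ l⁻¹ * ‖y‖ :=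
  (hG.resolvent hl).le_of_opNorm_le (LinearMap.mkContinuous_norm_le _ (by positivity) _) y

lemma mem_graph_iff_resolvent {x y : E} :
    (x, y) ∈ G.graph ↔ hG.resolvent hl (l • x - (y - c • x)) = x := by
  rw [resolvent_apply]
  refine ⟨fun h => ?_, fun h => ?_⟩
  · obtain ⟨z, rfl, rfl⟩ := (LinearPMap.mem_graph_iff G).mp h
    rw [← shiftEquiv_apply hG hl, LinearEquiv.symm_apply_apply]
  · have hz := (hG.shiftEquiv hl).apply_symm_apply (l • x - (y - c • x))
    rw [shiftEquiv_apply, h, sub_right_inj, sub_left_inj] at hz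
    exact (LinearPMap.mem_graph_iff G).mpr ⟨_, h, hz⟩

include hG in
lemma isClosed_graph : IsClosed (G.graph : Set (E × E)) := by
  have hgraph : (G.graph : Set (E × E)) =
      {p | hG.resolvent one_pos ((1 : ℝ) • p.1 - (p.2 - c • p.1)) = p.1} :=
    Set.ext fun _ => hG.mem_graph_iff_resolvent one_pos
  rw [hgraph]
  exact isClosed_eq (by fun_prop) continuous_fst

include hG in
lemma integral_mem_graph [CompleteSpace E] {f g : ℝ → E} (hf : ContinuousOn f (Ici 0))
    (hg : ContinuousOn g (Ici 0)) (h : ∀ t, 0 ≤ t → (f t, g t) ∈ G.graph) {t : ℝ} (ht : 0 ≤ t) :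
    (∫ s in (0 : ℝ)..t, f s, ∫ s in (0 : ℝ)..t, g s) ∈ G.graph := by
  have hfi := intervalIntegrable_of_continuousOn_Ici hf le_rfl ht
  have hgi := intervalIntegrable_of_continuousOn_Ici hg le_rfl ht
  have hsmul : ∀ r : ℝ, IntervalIntegrable (fun s => r • f s) volume 0 t := fun r => hfi.smul r
  have hsub : IntervalIntegrable (fun s => g s - c • f s) volume 0 t := hgi.sub (hsmul c)
  rw [hG.mem_graph_iff_resolvent one_pos, ← intervalIntegral.integral_smul,
    ← intervalIntegral.integral_smul, ← intervalIntegral.integral_sub hgi (hsmul c),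
    ← intervalIntegral.integral_sub (hsmul 1) hsub,
    ← ContinuousLinearMap.intervalIntegral_comp_comm _ ((hsmul 1).sub hsub)]
  refine intervalIntegral.integral_congr fun s hs => ?_
  rw [uIcc_of_le ht] at hs
  exact (hG.mem_graph_iff_resolvent one_pos).mp (h s hs.1)

include hG in
lemma dense_domain [CompleteSpace E] : Dense (G.domain : Set E) := by
  rw [Submodule.dense_iff_topologicalClosure_eq_top, Submodule.topologicalClosure_eq_top_iff,
    Submodule.eq_bot_iff]
  intro y hy
  obtain ⟨x, hx⟩ := hG.2 1 one_pos y
  have horth : (⟪(x : E), y⟫_ℂ).re = 0 := by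
    rw [(Submodule.mem_orthogonal _ _).mp hy _ x.2, Complex.zero_re]
  rw [← hx, inner_sub_right, Complex.sub_re, re_inner_self_smul] at horth
  have hzero : x = 0 :=
    Subtype.ext (by simpa using (by linarith [hG.1 x] : ‖(x : E)‖ ^ 2 ≤ 0))
  rw [← hx, hzero]
  simp

/-- The Yosida approximation `(G - c) l (l - (G - c))⁻¹` of `G - c`. -/
def yosida : E →L[ℂ] E := (l : ℂ) • ((l : ℂ) • hG.resolvent hl - 1)

lemma yosida_apply (x : E) : hG.yosida hl x = l • (l • hG.resolvent hl x - x) := by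
  simp only [yosida, smul_apply, sub_apply, one_apply_eq_self, Complex.coe_smul]

lemma yosida_mem_graph (x : E) :
    (x + l⁻¹ • hG.yosida hl x, hG.yosida hl x + c • (x + l⁻¹ • hG.yosida hl x)) ∈ G.graph := by
  rw [hG.mem_graph_iff_resolvent hl, add_sub_cancel_right, smul_add, smul_inv_smul₀ hl.ne',
    add_sub_cancel_right, yosida_apply, inv_smul_smul₀ hl.ne', add_sub_cancel,
    ← Complex.coe_smul, map_smul, Complex.coe_smul]

lemma norm_yosida_apply_le {x y : E} (h : (x, y) ∈ G.graph) :
    ‖hG.yosida hl x‖ ≤ ‖y - c • x‖ := by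
  have hyosida : hG.yosida hl x = l • hG.resolvent hl (y - c • x) := by
    have hres := (hG.mem_graph_iff_resolvent hl).mp h
    rw [map_sub, ← Complex.coe_smul l x, map_smul, Complex.coe_smul, sub_eq_iff_eq_add] at hres
    rw [yosida_apply, hres, add_sub_cancel_left]
  calc ‖hG.yosida hl x‖ = l * ‖hG.resolvent hl (y - c • x)‖ := by
        rw [hyosida, norm_smul, Real.norm_of_nonneg hl.le]
    _ ≤ l * (l⁻¹ * ‖y - c • x‖) := by
        gcongr
        exact hG.norm_resolvent_apply_le hl _
    _ = ‖y - c • x‖ := mul_inv_cancel_left₀ hl.ne' _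

lemma re_inner_yosida_sub_le {m : ℝ} (hm : 0 < m) (x y : E) :
    (⟪x - y, hG.yosida hl x - hG.yosida hm y⟫_ℂ).re ≤
      (l⁻¹ * ‖hG.yosida hl x‖ + m⁻¹ * ‖hG.yosida hm y‖) *
        (‖hG.yosida hl x‖ + ‖hG.yosida hm y‖) := by
  set a := hG.yosida hl x
  set b := hG.yosida hm y
  have hdiss : (⟪(x + l⁻¹ • a) - (y + m⁻¹ • b), a - b⟫_ℂ).re ≤ 0 := by
    refine hG.re_inner_nonpos ?_
    have hsub := G.graph.sub_mem (hG.yosida_mem_graph hl x) (hG.yosida_mem_graph hm y)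
    rwa [Prod.mk_sub_mk, add_sub_add_comm (hG.yosida hl x), ← smul_sub] at hsub
  have hsplit : x - y = ((x + l⁻¹ • a) - (y + m⁻¹ • b)) - (l⁻¹ • a - m⁻¹ • b) := by abel
  have herr : -(⟪l⁻¹ • a - m⁻¹ • b, a - b⟫_ℂ).re ≤ ‖l⁻¹ • a - m⁻¹ • b‖ * ‖a - b‖ :=
    (neg_le_abs _).trans ((Complex.abs_re_le_norm _).trans (norm_inner_le_norm _ _))
  have hnorm : ‖l⁻¹ • a - m⁻¹ • b‖ ≤ l⁻¹ * ‖a‖ + m⁻¹ * ‖b‖ := by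
    refine (norm_sub_le _ _).trans_eq ?_
    rw [norm_smul, norm_smul, Real.norm_of_nonneg (inv_nonneg.mpr hl.le),
      Real.norm_of_nonneg (inv_nonneg.mpr hm.le)]
  rw [hsplit, inner_sub_left, Complex.sub_re]
  calc _ ≤ ‖l⁻¹ • a - m⁻¹ • b‖ * ‖a - b‖ := by linarith
    _ ≤ _ := by
      gcongr
      exact norm_sub_le a b

lemma re_inner_yosida_le (x : E) : (⟪x, hG.yosida hl x⟫_ℂ).re ≤ 0 := by
  have hdiss := hG.re_inner_nonpos (hG.yosida_mem_graph hl x)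
  have hsq : (⟪l⁻¹ • hG.yosida hl x, hG.yosida hl x⟫_ℂ).re = l⁻¹ * ‖hG.yosida hl x‖ ^ 2 := by
    rw [← inner_conj_symm, Complex.conj_re, re_inner_self_smul]
  rw [inner_add_left, Complex.add_re, hsq] at hdiss
  have hnonneg : 0 ≤ l⁻¹ * ‖hG.yosida hl x‖ ^ 2 := by positivity
  linarith

section Flow

variable [CompleteSpace E]

/-- The solution operator at time `t` of the Yosida-regularized problem `X' = (G_l + c) X`, where
`G_l` is the Yosida approximation of `G - c`. -/
def yosidaFlow (t : ℝ) : E →L[ℂ] E :=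
  NormedSpace.exp (t • (hG.yosida hl + c • (1 : E →L[ℂ] E)))

lemma yosidaFlow_zero (x : E) : hG.yosidaFlow hl 0 x = x := by simp [yosidaFlow]

lemma hasDerivAt_yosidaFlow (x : E) (t : ℝ) : HasDerivAt (fun t => hG.yosidaFlow hl t x)
    (hG.yosida hl (hG.yosidaFlow hl t x) + c • hG.yosidaFlow hl t x) t := by
  have hexp := hasDerivAt_exp_smul_const' (𝕂 := ℝ) (hG.yosida hl + c • (1 : E →L[ℂ] E)) t
  have heval := ((ContinuousLinearMap.apply ℂ E x).restrictScalars ℝ).hasFDerivAt.comp_hasDerivAt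
    t hexp
  simpa [yosidaFlow, Function.comp_def] using heval

lemma yosida_yosidaFlow (x : E) (t : ℝ) :
    hG.yosida hl (hG.yosidaFlow hl t x) = hG.yosidaFlow hl t (hG.yosida hl x) := by
  have hcomm : Commute (hG.yosida hl) (t • (hG.yosida hl + c • (1 : E →L[ℂ] E))) :=
    ((Commute.refl _).add_right ((Commute.one_right _).smul_right c)).smul_right t
  exact DFunLike.congr_fun hcomm.exp_right.eq x

lemma norm_yosidaFlow_apply_le (x : E) {t : ℝ} (ht : 0 ≤ t) :
    ‖hG.yosidaFlow hl t x‖ ≤ Real.exp (c * t) * ‖x‖ := by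
  have hle := norm_le_exp_mul_of_re_inner_deriv_le (c := c)
    (fun s _ => (hG.hasDerivAt_yosidaFlow hl x s).hasDerivWithinAt) (fun s _ => ?_) ht
  · rwa [yosidaFlow_zero] at hle
  · rw [inner_add_right, Complex.add_re, re_inner_self_smul]
    linarith [hG.re_inner_yosida_le hl (hG.yosidaFlow hl s x)]

lemma norm_yosidaFlow_apply_le_of_mem_Icc (x : E) {t T : ℝ} (ht : t ∈ Icc 0 T) :
    ‖hG.yosidaFlow hl t x‖ ≤ Real.exp (|c| * T) * ‖x‖ := by
  refine (hG.norm_yosidaFlow_apply_le hl x ht.1).trans ?_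
  gcongr ?_ * _
  exact Real.exp_le_exp.mpr (mul_le_mul (le_abs_self c) ht.2 ht.1 (abs_nonneg c))

lemma norm_yosida_yosidaFlow_le {x y : E} (h : (x, y) ∈ G.graph) {t T : ℝ} (ht : t ∈ Icc 0 T) :
    ‖hG.yosida hl (hG.yosidaFlow hl t x)‖ ≤ Real.exp (|c| * T) * ‖y - c • x‖ := by
  rw [yosida_yosidaFlow]
  refine (hG.norm_yosidaFlow_apply_le_of_mem_Icc hl _ ht).trans ?_
  gcongr
  exact hG.norm_yosida_apply_le hl h

lemma norm_sq_yosidaFlow_sub_le {m T : ℝ} (hm : 0 < m) {x y : E} (h : (x, y) ∈ G.graph) {t : ℝ}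
    (ht : t ∈ Icc 0 T) :
    ‖hG.yosidaFlow hl t x - hG.yosidaFlow hm t x‖ ^ 2 ≤ gronwallBound 0 (2 * |c|)
      (4 * (l⁻¹ + m⁻¹) * (Real.exp (|c| * T) * ‖y - c • x‖) ^ 2) T := by
  set Q := Real.exp (|c| * T) * ‖y - c • x‖
  set X := fun s => hG.yosidaFlow hl s x
  set Y := fun s => hG.yosidaFlow hm s x
  have hderiv : ∀ s ∈ Icc 0 T, HasDerivWithinAt (fun s => X s - Y s)
      ((hG.yosida hl (X s) - hG.yosida hm (Y s)) + c • (X s - Y s)) (Icc 0 T) s := fun s _ => by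
    have hsub := (hG.hasDerivAt_yosidaFlow hl x s).sub (hG.hasDerivAt_yosidaFlow hm x s)
    rw [add_sub_add_comm, ← smul_sub] at hsub
    exact hsub.hasDerivWithinAt
  have hle : ∀ s ∈ Icc 0 T,
      (⟪X s - Y s, (hG.yosida hl (X s) - hG.yosida hm (Y s)) + c • (X s - Y s)⟫_ℂ).re ≤
        |c| * ‖X s - Y s‖ ^ 2 + 2 * (l⁻¹ + m⁻¹) * Q ^ 2 := fun s hs => by
    have hX : ‖hG.yosida hl (X s)‖ ≤ Q := hG.norm_yosida_yosidaFlow_le hl h hs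
    have hY : ‖hG.yosida hm (Y s)‖ ≤ Q := hG.norm_yosida_yosidaFlow_le hm h hs
    rw [inner_add_right, Complex.add_re, re_inner_self_smul, add_comm]
    gcongr
    · exact le_abs_self c
    · calc _ ≤ _ := hG.re_inner_yosida_sub_le hl hm (X s) (Y s)
        _ ≤ (l⁻¹ * Q + m⁻¹ * Q) * (Q + Q) := by gcongr
        _ = 2 * (l⁻¹ + m⁻¹) * Q ^ 2 := by ring
  have hgronwall := norm_sq_le_gronwallBound hderiv hle ht
  have hzero : X 0 - Y 0 = 0 := by simp only [X, Y, yosidaFlow_zero, sub_self]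
  rw [hzero, norm_zero, zero_pow two_ne_zero, sub_zero, ← mul_assoc, ← mul_assoc] at hgronwall
  norm_num only at hgronwall
  exact hgronwall.trans (gronwallBound_mono le_rfl (by positivity) (by positivity) ht.2)

lemma uniformCauchySeqOn_yosidaFlow (x : E) (T : ℝ) :
    UniformCauchySeqOn (fun (n : ℕ) t => hG.yosidaFlow (Nat.cast_add_one_pos n) t x) atTop
      (Icc 0 T) := by
  refine uniformCauchySeqOn_apply_of_dense (M := Real.exp (|c| * T)) hG.dense_domain
    (fun n t ht => ContinuousLinearMap.opNorm_le_bound _ (by positivity) fun y =>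
      hG.norm_yosidaFlow_apply_le_of_mem_Icc _ y ht)
    (fun y hy => ?_) x
  set Q := Real.exp (|c| * T) * ‖G ⟨y, hy⟩ - c • y‖
  have hinv : Tendsto (fun n : ℕ => ((n : ℝ) + 1)⁻¹) atTop (𝓝 0) := by
    simpa using tendsto_one_div_add_atTop_nhds_zero_nat (𝕜 := ℝ)
  have hbound : Tendsto (fun p : ℕ × ℕ => gronwallBound 0 (2 * |c|)
      (4 * (((p.1 : ℝ) + 1)⁻¹ + ((p.2 : ℝ) + 1)⁻¹) * Q ^ 2) T) (atTop ×ˢ atTop) (𝓝 0) := by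
    have hcont := (gronwallBound_continuous_ε 0 (2 * |c|) T).tendsto 0
    rw [gronwallBound_ε0_δ0] at hcont
    refine hcont.comp ?_
    simpa using (((hinv.comp tendsto_fst).add (hinv.comp tendsto_snd)).const_mul 4).mul_const
      (Q ^ 2)
  intro u hu
  obtain ⟨ε, hε, hεu⟩ := Metric.mem_uniformity_dist.mp hu
  filter_upwards [hbound.eventually_lt_const (pow_pos hε 2)] with p hp t ht
  refine hεu ?_
  rw [dist_eq_norm]
  exact lt_of_pow_lt_pow_left₀ 2 hε.le
    ((hG.norm_sq_yosidaFlow_sub_le _ _ (G.mem_graph ⟨y, hy⟩) ht).trans_lt hp)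

lemma yosidaFlow_sub_eq (x : E) (t : ℝ) :
    hG.yosidaFlow hl t x - x = hG.yosida hl (∫ s in (0 : ℝ)..t, hG.yosidaFlow hl s x) +
      c • ∫ s in (0 : ℝ)..t, hG.yosidaFlow hl s x := by
  have hcont : Continuous fun s => hG.yosidaFlow hl s x :=
    continuous_iff_continuousAt.mpr fun s => (hG.hasDerivAt_yosidaFlow hl x s).continuousAt
  have hftc := intervalIntegral.integral_eq_sub_of_hasDerivAt (a := 0) (b := t)
    (fun s _ => hG.hasDerivAt_yosidaFlow hl x s)
    (Continuous.intervalIntegrable (by fun_prop) _ _)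
  rw [yosidaFlow_zero] at hftc
  rw [← hftc, intervalIntegral.integral_add (Continuous.intervalIntegrable (by fun_prop) _ _)
    (Continuous.intervalIntegrable (by fun_prop) _ _), intervalIntegral.integral_smul,
    ContinuousLinearMap.intervalIntegral_comp_comm _ (hcont.intervalIntegrable _ _)]

include hG in
theorem exists_isMildSolution (x₀ : E) : ∃ X, IsMildSolution G x₀ X := by
  set S := fun n : ℕ => hG.yosidaFlow (Nat.cast_add_one_pos n)
  obtain ⟨X, hX, hlim⟩ := exists_continuousOn_limit_of_uniformCauchySeqOn
    (fun n => fun t _ =>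
      (hG.hasDerivAt_yosidaFlow (Nat.cast_add_one_pos n) x₀ t).continuousAt.continuousWithinAt)
    (hG.uniformCauchySeqOn_yosidaFlow x₀)
  refine ⟨X, isMildSolution_iff_mem_graph.mpr ⟨hX, fun t ht => ?_⟩⟩
  obtain ⟨hXt, hint⟩ := hlim t ht
  have hinv : Tendsto (fun n : ℕ => ((n : ℝ) + 1)⁻¹) atTop (𝓝 0) := by
    simpa using tendsto_one_div_add_atTop_nhds_zero_nat (𝕜 := ℝ)
  set I := fun n => ∫ s in (0 : ℝ)..t, S n s x₀
  have hyosida : Tendsto (fun n : ℕ => hG.yosida (Nat.cast_add_one_pos n) (I n)) atTop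
      (𝓝 (X t - x₀ - c • ∫ s in (0 : ℝ)..t, X s)) :=
    ((hXt.sub_const x₀).sub (hint.const_smul c)).congr fun n => by
      rw [yosidaFlow_sub_eq, add_sub_cancel_right]
  have hreg : Tendsto (fun n : ℕ => I n + ((n : ℝ) + 1)⁻¹ •
      hG.yosida (Nat.cast_add_one_pos n) (I n)) atTop (𝓝 (∫ s in (0 : ℝ)..t, X s)) := by
    simpa using hint.add (hinv.smul hyosida)
  have hmem := hG.isClosed_graph.mem_of_tendsto
    (hreg.prodMk_nhds (hyosida.add (hreg.const_smul c)))
    (Eventually.of_forall fun n => hG.yosida_mem_graph (Nat.cast_add_one_pos n) (I n))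
  rwa [sub_add_cancel] at hmem

end Flow

end IsMaximalDissipativeShift

lemma IsMildSolution.sub {x₀ y₀ : E} {X Y : ℝ → E}
    (hX : IsMildSolution G x₀ X) (hY : IsMildSolution G y₀ Y) :
    IsMildSolution G (x₀ - y₀) (fun t => X t - Y t) := by
  rw [isMildSolution_iff_mem_graph] at hX hY ⊢
  refine ⟨hX.1.sub hY.1, fun t ht => ?_⟩
  have hsub := G.graph.sub_mem (hX.2 t ht) (hY.2 t ht)
  rwa [Prod.mk_sub_mk, ← intervalIntegral.integral_sub
    (intervalIntegrable_of_continuousOn_Ici hX.1 le_rfl ht)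
    (intervalIntegrable_of_continuousOn_Ici hY.1 le_rfl ht), sub_sub_sub_comm] at hsub

namespace IsMaximalDissipativeShift

variable [CompleteSpace E] (hG : IsMaximalDissipativeShift G c)

include hG

lemma isMildSolution_zero_eq_zero {X : ℝ → E} (hX : IsMildSolution G 0 X) {t : ℝ} (ht : 0 ≤ t) :
    X t = 0 := by
  rw [isMildSolution_iff_mem_graph] at hX
  simp only [sub_zero] at hX
  have hint : ∫ s in (0 : ℝ)..t, X s = 0 := by
    simpa using norm_le_exp_mul_of_re_inner_deriv_le
      (fun s hs => hasDerivWithinAt_integral_Ici hX.1 hs)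
      (fun s hs => hG.re_inner_le (hX.2 s hs)) ht
  have hmem := hX.2 t ht
  rw [hint] at hmem
  exact G.graph_fst_eq_zero_snd hmem rfl

theorem isMildSolution_eqOn {x₀ : E} {X Y : ℝ → E} (hX : IsMildSolution G x₀ X)
    (hY : IsMildSolution G x₀ Y) : EqOn X Y (Ici 0) := fun _ ht =>
  sub_eq_zero.mp (hG.isMildSolution_zero_eq_zero (sub_self x₀ ▸ hX.sub hY) ht)

theorem isClassicalSolution {x₀ : E} (h₀ : x₀ ∈ G.domain) {X : ℝ → E}
    (hX : IsMildSolution G x₀ X) : IsClassicalSolution G x₀ X := by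
  -- `X'` has to be the mild solution issued from `G x₀`; conversely, its primitive is mild.
  obtain ⟨Y, hY⟩ := hG.exists_isMildSolution (G ⟨x₀, h₀⟩)
  rw [isMildSolution_iff_mem_graph] at hY
  set Z : ℝ → E := fun t => x₀ + ∫ s in (0 : ℝ)..t, Y s
  have hZderiv : ∀ t, 0 ≤ t → HasDerivWithinAt Z (Y t) (Ici 0) t := fun t ht =>
    (hasDerivWithinAt_integral_Ici hY.1 ht).const_add x₀
  have hZcont : ContinuousOn Z (Ici 0) := fun t ht => (hZderiv t ht).continuousWithinAt
  have hZgraph : ∀ t, 0 ≤ t → (Z t, Y t) ∈ G.graph := fun t ht => by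
    have hadd := G.graph.add_mem (G.mem_graph ⟨x₀, h₀⟩) (hY.2 t ht)
    rwa [Prod.mk_add_mk, add_sub_cancel] at hadd
  have hZmild : IsMildSolution G x₀ Z := isMildSolution_iff_mem_graph.mpr ⟨hZcont, fun t ht => by
    rw [show Z t - x₀ = ∫ s in (0 : ℝ)..t, Y s from add_sub_cancel_left _ _]
    exact hG.integral_mem_graph hZcont hY.1 hZgraph ht⟩
  have heq := hG.isMildSolution_eqOn hX hZmild
  refine ⟨?_, hZcont.congr heq, Y, hY.1, fun t ht => ⟨?_, ?_⟩⟩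
  · rw [heq self_mem_Ici]
    simp [Z]
  · rw [heq ht]
    exact mem_graph_iff_exists_mem_domain.mp (hZgraph t ht)
  · exact (hZderiv t ht).congr heq (heq ht)

end IsMaximalDissipativeShift

end Evolution

section AbsolutelyContinuous

lemma absolutelyContinuousOnInterval_of_dist_le {X Y : Type*} [PseudoMetricSpace X]
    [PseudoMetricSpace Y] {f : ℝ → X} {g : ℝ → Y} {a b : ℝ}
    (hg : AbsolutelyContinuousOnInterval g a b)
    (hle : ∀ x ∈ uIcc a b, ∀ y ∈ uIcc a b, dist (f x) (f y) ≤ dist (g x) (g y)) :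
    AbsolutelyContinuousOnInterval f a b := by
  refine squeeze_zero' (Eventually.of_forall fun E => Finset.sum_nonneg fun _ _ => dist_nonneg)
    ?_ hg
  exact mem_inf_of_right (mem_principal.mpr fun E hE =>
    Finset.sum_le_sum fun i hi => hle _ (hE.1 i hi).1 _ (hE.1 i hi).2)

variable {F : Type*} [NormedAddCommGroup F] [NormedSpace ℝ F] {f g : ℝ → F} {a b : ℝ}

lemma absolutelyContinuousOnInterval_add_integral (hg : IntervalIntegrable g volume a b) (k : F) :
    AbsolutelyContinuousOnInterval (fun x => k + ∫ s in a..x, g s) a b := by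
  have hint : ∀ x ∈ uIcc a b, IntervalIntegrable g volume a x := fun x hx =>
    hg.mono_set (uIcc_subset_uIcc_left hx)
  refine absolutelyContinuousOnInterval_of_dist_le
    (hg.norm.absolutelyContinuousOnInterval_intervalIntegral left_mem_uIcc) fun x hx y hy => ?_
  rw [dist_add_left, dist_eq_norm, Real.dist_eq,
    intervalIntegral.integral_interval_sub_left (hint x hx) (hint y hy),
    intervalIntegral.integral_interval_sub_left (hint x hx).norm (hint y hy).norm]
  exact intervalIntegral.norm_integral_le_abs_integral_norm

variable [CompleteSpace F]

lemma ae_hasDerivAt_add_integral (hg : IntervalIntegrable g volume a b) (k : F) :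
    ∀ᵐ x, x ∈ uIcc a b → HasDerivAt (fun x => k + ∫ s in a..x, g s) (g x) x :=
  hg.ae_hasDerivAt_integral.mono fun _ hx hmem => (hx hmem a left_mem_uIcc).const_add k

lemma integral_eq_sub_of_ae_hasDerivAt (hf : AbsolutelyContinuousOnInterval f a b)
    (hderiv : ∀ᵐ x, x ∈ uIcc a b → HasDerivAt f (g x) x) (hg : IntervalIntegrable g volume a b) :
    ∫ x in a..b, g x = f b - f a := by
  obtain ⟨C, hC⟩ := (hf.fun_sub
    (absolutelyContinuousOnInterval_add_integral hg 0)).const_of_ae_hasDerivAt_zero (by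
      filter_upwards [hderiv, ae_hasDerivAt_add_integral hg 0] with x hfx hgx hx
      simpa only [sub_self] using (hfx hx).fun_sub (hgx hx))
  have hends := (hC b right_mem_uIcc).trans (hC a left_mem_uIcc).symm
  simp only [zero_add, intervalIntegral.integral_same, sub_zero] at hends
  rw [← hends, sub_sub_cancel]

lemma integral_deriv_smul_of_ae_hasDerivAt (hf : AbsolutelyContinuousOnInterval f a b)
    (hderiv : ∀ᵐ x, x ∈ uIcc a b → HasDerivAt f (g x) x) (hg : IntervalIntegrable g volume a b)
    {φ : ℝ → ℝ} (hφ : ContDiff ℝ 1 φ) (hφa : φ a = 0) (hφb : φ b = 0) :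
    ∫ x in a..b, deriv φ x • f x = - ∫ x in a..b, φ x • g x := by
  have hint_deriv : IntervalIntegrable (fun x => deriv φ x • f x) volume a b :=
    (hφ.continuous_deriv_one.continuousOn.smul hf.continuousOn).intervalIntegrable
  have hint : IntervalIntegrable (fun x => φ x • g x) volume a b :=
    hg.continuousOn_smul hφ.continuous.continuousOn
  have hftc := integral_eq_sub_of_ae_hasDerivAt
    (hφ.contDiffOn.absolutelyContinuousOnInterval.smul hf)
    (hderiv.mono fun x hx hmem =>
      (hφ.differentiable_one x).hasDerivAt.smul (hx hmem)) (hint.add hint_deriv)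
  simp only [Pi.smul_apply', hφa, hφb, zero_smul, sub_zero] at hftc
  rw [intervalIntegral.integral_add hint hint_deriv] at hftc
  rwa [eq_neg_iff_add_eq_zero, add_comm]

end AbsolutelyContinuous

lemma integral_re_inner_add_integral {E : Type*} [NormedAddCommGroup E] [InnerProductSpace ℂ E]
    [CompleteSpace E] {g : ℝ → E} {a b : ℝ} (hg : IntervalIntegrable g volume a b) (k : E) :
    ∫ x in a..b, (⟪k + ∫ s in a..x, g s, g x⟫_ℂ).re =
      (‖k + ∫ s in a..b, g s‖ ^ 2 - ‖k‖ ^ 2) / 2 := by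
  have hac := absolutelyContinuousOnInterval_add_integral hg k
  have hac_norm := absolutelyContinuousOnInterval_of_dist_le hac
    (f := fun x => ‖k + ∫ s in a..x, g s‖) fun x _ y _ => by
      simpa only [dist_eq_norm] using dist_norm_norm_le _ _
  have hderiv : ∀ᵐ x, x ∈ uIoc a b →
      deriv ((fun x => ‖k + ∫ s in a..x, g s‖) * fun x => ‖k + ∫ s in a..x, g s‖) x =
        2 * (⟪k + ∫ s in a..x, g s, g x⟫_ℂ).re := by
    filter_upwards [ae_hasDerivAt_add_integral hg k] with x hx hmem
    have hsq := hasDerivWithinAt_norm_sq (s := univ)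
      (hx (uIoc_subset_uIcc hmem)).hasDerivWithinAt
    simp only [sq] at hsq
    exact (hsq.hasDerivAt univ_mem).deriv
  have hftc := (hac_norm.mul hac_norm).integral_deriv_eq_sub
  rw [intervalIntegral.integral_congr_ae hderiv, intervalIntegral.integral_const_mul] at hftc
  simp only [Pi.mul_apply, intervalIntegral.integral_same, add_zero] at hftc
  linarith

section Sobolev

/-- The class `C_c^∞(s)` of real test functions supported in `s`. -/
structure IsTestFunction (s : Set ℝ) (φ : ℝ → ℝ) : Prop where
  contDiff : ContDiff ℝ ∞ φ
  hasCompactSupport : HasCompactSupport φ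
  tsupport_subset : tsupport φ ⊆ s

namespace IsTestFunction

variable {s : Set ℝ} {φ ψ : ℝ → ℝ} {a b : ℝ}

lemma eq_zero_of_notMem (hφ : IsTestFunction s φ) {x : ℝ} (hx : x ∉ s) : φ x = 0 :=
  image_eq_zero_of_notMem_tsupport fun h => hx (hφ.tsupport_subset h)

lemma sub_const_mul (hφ : IsTestFunction s φ) (hψ : IsTestFunction s ψ) (m : ℝ) :
    IsTestFunction s fun x => φ x - m * ψ x where
  contDiff := hφ.contDiff.sub (contDiff_const.mul hψ.contDiff)
  hasCompactSupport := hφ.hasCompactSupport.sub hψ.hasCompactSupport.mul_left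
  tsupport_subset := (tsupport_sub φ fun x => m * ψ x).trans
    (union_subset hφ.tsupport_subset (tsupport_mul_subset_right.trans hψ.tsupport_subset))

end IsTestFunction

lemma exists_isTestFunction_integral_eq_one {a b : ℝ} (hab : a < b) :
    ∃ χ, IsTestFunction (Ioo a b) χ ∧ ∫ x in a..b, χ x = 1 := by
  let f : ContDiffBump ((a + b) / 2) :=
    ⟨(b - a) / 8, (b - a) / 4, by linarith, by linarith⟩
  have hχ : IsTestFunction (Ioo a b) (f.normed volume) := by
    refine ⟨f.contDiff_normed, f.hasCompactSupport_normed, ?_⟩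
    rw [f.tsupport_normed_eq, Real.closedBall_eq_Icc]
    exact Icc_subset_Ioo (show a < (a + b) / 2 - (b - a) / 4 by linarith)
      (show (a + b) / 2 + (b - a) / 4 < b by linarith)
  refine ⟨_, hχ, ?_⟩
  rw [intervalIntegral.integral_of_le hab.le, integral_Ioc_eq_integral_Ioo,
    setIntegral_eq_integral_of_forall_compl_eq_zero fun x hx => hχ.eq_zero_of_notMem hx]
  exact f.integral_normed

lemma integral_eq_zero_of_notMem_Icc {θ : ℝ → ℝ} (hθ : Continuous θ) {a b c d : ℝ} (hac : a < c)
    (hdb : d < b) (hsupp : ∀ x ∉ Icc c d, θ x = 0) (hint : ∫ x in a..b, θ x = 0) {x : ℝ}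
    (hx : x ∉ Icc c d) : ∫ s in a..x, θ s = 0 := by
  have hvanish : ∀ y, (∀ s ∈ uIoc y x, s ∉ Icc c d) → ∫ s in y..x, θ s = 0 := fun y hy =>
    intervalIntegral.integral_zero_ae (Eventually.of_forall fun s hs => hsupp s (hy s hs))
  rcases lt_or_ge x c with hxc | hxc
  · exact hvanish a fun s hs hcd => (hcd.1.trans hs.2).not_gt (max_lt hac hxc)
  · have hdx : d < x := lt_of_not_ge fun h => hx ⟨hxc, h⟩
    rw [← intervalIntegral.integral_add_adjacent_intervals (hθ.intervalIntegrable a b)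
      (hθ.intervalIntegrable b x), hint, zero_add]
    exact hvanish b fun s hs hcd => (hs.1.trans_le hcd.2).not_gt (lt_min hdb hdx)

lemma exists_subset_Icc_of_isCompact {K : Set ℝ} (hK : IsCompact K) {a b : ℝ} (hab : a < b)
    (hKab : K ⊆ Ioo a b) : ∃ c d, a < c ∧ d < b ∧ K ⊆ Icc c d := by
  rcases K.eq_empty_or_nonempty with rfl | hne
  · exact ⟨b, a, hab, hab, empty_subset _⟩
  · obtain ⟨c, hc⟩ := hK.exists_isLeast hne
    obtain ⟨d, hd⟩ := hK.exists_isGreatest hne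
    exact ⟨c, d, (hKab hc.1).1, (hKab hd.1).2, fun x hx => ⟨hc.2 hx, hd.2 hx⟩⟩

lemma IsTestFunction.exists_deriv_eq {θ : ℝ → ℝ} {a b : ℝ} (hab : a < b)
    (hθ : IsTestFunction (Ioo a b) θ) (hint : ∫ x in a..b, θ x = 0) :
    ∃ φ, IsTestFunction (Ioo a b) φ ∧ deriv φ = θ := by
  obtain ⟨c, d, hac, hdb, hcd⟩ :=
    exists_subset_Icc_of_isCompact hθ.hasCompactSupport.isCompact hab hθ.tsupport_subset
  have hderiv : deriv (fun x => ∫ s in a..x, θ s) = θ :=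
    funext fun x => hθ.contDiff.continuous.deriv_integral θ a x
  have hsupp : tsupport (fun x => ∫ s in a..x, θ s) ⊆ Icc c d := by
    refine closure_minimal (Function.support_subset_iff'.mpr fun x hx => ?_) isClosed_Icc
    exact integral_eq_zero_of_notMem_Icc hθ.contDiff.continuous hac hdb
      (fun y hy => image_eq_zero_of_notMem_tsupport fun h => hy (hcd h)) hint hx
  refine ⟨_, ⟨?_, ?_, hsupp.trans (Icc_subset_Ioo hac hdb)⟩, hderiv⟩
  · rw [contDiff_infty_iff_deriv, hderiv]
    exact ⟨fun x =>
      (hθ.contDiff.continuous.integral_hasStrictDerivAt a x).hasDerivAt.differentiableAt,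
      hθ.contDiff⟩
  · exact HasCompactSupport.of_support_subset_isCompact isCompact_Icc
      ((subset_tsupport _).trans hsupp)

section DuBoisReymond

variable {F : Type*} [NormedAddCommGroup F] [NormedSpace ℝ F] [CompleteSpace F]
  {a b : ℝ} {f : ℝ → F}

lemma exists_integral_smul_eq_integral_smul_const (hab : a < b)
    (hf : IntervalIntegrable f volume a b)
    (hzero : ∀ φ, IsTestFunction (Ioo a b) φ → ∫ x in a..b, deriv φ x • f x = 0) :
    ∃ k, ∀ ψ, IsTestFunction (Ioo a b) ψ →
      ∫ x in a..b, ψ x • f x = ∫ x in a..b, ψ x • k := by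
  obtain ⟨χ, hχ, hχ_int⟩ := exists_isTestFunction_integral_eq_one hab
  have hint : ∀ {ψ}, IsTestFunction (Ioo a b) ψ →
      IntervalIntegrable (fun x => ψ x • f x) volume a b := fun hψ =>
    hf.continuousOn_smul hψ.contDiff.continuous.continuousOn
  refine ⟨∫ x in a..b, χ x • f x, fun ψ hψ => ?_⟩
  -- `ψ - (∫ ψ) χ` has integral zero, hence is the derivative of a test function.
  set m := ∫ x in a..b, ψ x with hm
  have hθ_int : ∫ x in a..b, (ψ x - m * χ x) = 0 := by
    rw [intervalIntegral.integral_sub (hψ.contDiff.continuous.intervalIntegrable a b)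
      ((hχ.contDiff.continuous.const_mul m).intervalIntegrable a b),
      intervalIntegral.integral_const_mul, hχ_int, mul_one, sub_self]
  obtain ⟨φ, hφ, hφ_deriv⟩ := (hψ.sub_const_mul hχ m).exists_deriv_eq hab hθ_int
  have hint_smul : IntervalIntegrable (fun x => m • χ x • f x) volume a b := (hint hχ).smul m
  have hφ_zero := hzero φ hφ
  simp only [hφ_deriv, sub_smul, mul_smul] at hφ_zero
  rw [intervalIntegral.integral_sub (hint hψ) hint_smul, intervalIntegral.integral_smul,
    sub_eq_zero] at hφ_zero
  rw [hφ_zero, intervalIntegral.integral_smul_const, ← hm]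

lemma eqOn_const_of_integral_deriv_smul_eq_zero (hab : a < b) (hf : ContinuousOn f (Icc a b))
    (hzero : ∀ φ, IsTestFunction (Ioo a b) φ → ∫ x in a..b, deriv φ x • f x = 0) :
    EqOn f (fun _ => f a) (Icc a b) := by
  have hfi : IntervalIntegrable f volume a b := hf.intervalIntegrable_of_Icc hab.le
  obtain ⟨k, hk⟩ := exists_integral_smul_eq_integral_smul_const hab hfi hzero
  have hfk : IntervalIntegrable (fun x => f x - k) volume a b := hfi.sub intervalIntegrable_const
  have hae : ∀ᵐ x, x ∈ Ioo a b → f x - k = 0 := by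
    refine isOpen_Ioo.ae_eq_zero_of_integral_contDiff_smul_eq_zero
      ((intervalIntegrable_iff_integrableOn_Ioo_of_le hab.le).mp hfk).locallyIntegrableOn
      fun ψ hψ_smooth hψ_compact hψ_supp => ?_
    have hψ : IsTestFunction (Ioo a b) ψ := ⟨hψ_smooth, hψ_compact, hψ_supp⟩
    rw [← setIntegral_eq_integral_of_forall_compl_eq_zero (s := Ioo a b)
      fun x hx => by rw [hψ.eq_zero_of_notMem hx, zero_smul], ← integral_Ioc_eq_integral_Ioo,
      ← intervalIntegral.integral_of_le hab.le]
    simp only [smul_sub]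
    rw [intervalIntegral.integral_sub (hfi.continuousOn_smul hψ_smooth.continuous.continuousOn)
      ((hψ_smooth.continuous.fun_smul continuous_const).intervalIntegrable a b), hk ψ hψ, sub_self]
  have hae_const : f =ᵐ[volume.restrict (Icc a b)] fun _ => k := by
    rw [← restrict_Ioo_eq_restrict_Icc]
    exact (ae_restrict_iff' measurableSet_Ioo).mpr
      (hae.mono fun x hx hmem => sub_eq_zero.mp (hx hmem))
  have heq : EqOn f (fun _ => k) (Icc a b) :=
    Measure.eqOn_Icc_of_ae_eq volume hab.ne hae_const hf continuousOn_const
  exact fun x hx => (heq hx).trans (heq (left_mem_Icc.mpr hab.le)).symm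

end DuBoisReymond

lemma integral_Ioo_eq_intervalIntegral {F : Type*} [NormedAddCommGroup F] [NormedSpace ℝ F]
    {a b : ℝ} (hab : a ≤ b) (f : ℝ → F) : ∫ x in Ioo a b, f x = ∫ x in a..b, f x := by
  rw [intervalIntegral.integral_of_le hab, integral_Ioc_eq_integral_Ioo]

lemma intervalIntegrable_of_integrableOn_Ioo {F : Type*} [NormedAddCommGroup F] {a b : ℝ}
    (hab : a ≤ b) {f : ℝ → F} (hf : IntegrableOn f (Ioo a b)) : IntervalIntegrable f volume a b :=
  (intervalIntegrable_iff_integrableOn_Ioo_of_le hab).mpr hf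

variable {U : Type*} [NormedAddCommGroup U] [InnerProductSpace ℂ U] {z w zc : ℝ → U}

lemma isWeakDeriv_iff : IsWeakDeriv z w ↔ ∀ φ, IsTestFunction (Ioo 0 1) φ →
    ∫ ρ in (0 : ℝ)..1, deriv φ ρ • z ρ = - ∫ ρ in (0 : ℝ)..1, φ ρ • w ρ := by
  simp only [← integral_Ioo_eq_intervalIntegral zero_le_one]
  exact ⟨fun h φ hφ => h φ hφ.contDiff hφ.hasCompactSupport hφ.tsupport_subset,
    fun h φ h_smooth h_compact h_supp => h φ ⟨h_smooth, h_compact, h_supp⟩⟩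

lemma isWeakDeriv_congr_ae {z' w' : ℝ → U} (hz : z =ᵐ[volume.restrict (Ioo 0 1)] z')
    (hw : w =ᵐ[volume.restrict (Ioo 0 1)] w') : IsWeakDeriv z w ↔ IsWeakDeriv z' w' := by
  have hcongr : ∀ {f g : ℝ → U}, f =ᵐ[volume.restrict (Ioo 0 1)] g → ∀ ψ : ℝ → ℝ,
      ∫ ρ in Ioo (0 : ℝ) 1, ψ ρ • f ρ = ∫ ρ in Ioo (0 : ℝ) 1, ψ ρ • g ρ := fun hfg ψ =>
    integral_congr_ae (hfg.mono fun ρ hρ => by simp only [hρ])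
  simp only [IsWeakDeriv, hcongr hz, hcongr hw]

variable [CompleteSpace U]

lemma isWeakDeriv_of_ae_hasDerivAt (hz : AbsolutelyContinuousOnInterval z 0 1)
    (hderiv : ∀ᵐ ρ, ρ ∈ uIcc (0 : ℝ) 1 → HasDerivAt z (w ρ) ρ) (hw : IntegrableOn w (Ioo 0 1)) :
    IsWeakDeriv z w := by
  refine isWeakDeriv_iff.mpr fun φ hφ => ?_
  exact integral_deriv_smul_of_ae_hasDerivAt hz hderiv
    (intervalIntegrable_of_integrableOn_Ioo zero_le_one hw) (hφ.contDiff.of_le (by simp))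
    (hφ.eq_zero_of_notMem (by simp)) (hφ.eq_zero_of_notMem (by simp))

lemma isWeakDeriv_add_integral (hw : IntegrableOn w (Ioo 0 1)) (k : U) :
    IsWeakDeriv (fun ρ => k + ∫ s in (0 : ℝ)..ρ, w s) w := by
  have hwi := intervalIntegrable_of_integrableOn_Ioo zero_le_one hw
  exact isWeakDeriv_of_ae_hasDerivAt (absolutelyContinuousOnInterval_add_integral hwi k)
    (ae_hasDerivAt_add_integral hwi k) hw

lemma IsWeakDeriv.eqOn_add_integral (h : IsWeakDeriv z w) (hw : IntegrableOn w (Ioo 0 1))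
    (hc : IsContRepr z zc) : EqOn zc (fun ρ => zc 0 + ∫ s in (0 : ℝ)..ρ, w s) (Icc 0 1) := by
  have hwi := intervalIntegrable_of_integrableOn_Ioo zero_le_one hw
  have hW : ContinuousOn (fun ρ => (0 : U) + ∫ s in (0 : ℝ)..ρ, w s) (Icc 0 1) := by
    simpa only [uIcc_of_le zero_le_one] using
      (absolutelyContinuousOnInterval_add_integral hwi 0).continuousOn
  have hconst := eqOn_const_of_integral_deriv_smul_eq_zero zero_lt_one (hc.1.sub hW)
    fun φ hφ => by
      have hφ' : ContinuousOn (deriv φ) (Icc 0 1) :=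
        (hφ.contDiff.continuous_deriv (by simp)).continuousOn
      simp only [Pi.sub_apply, smul_sub]
      rw [intervalIntegral.integral_sub ((hφ'.fun_smul hc.1).intervalIntegrable_of_Icc zero_le_one)
        ((hφ'.fun_smul hW).intervalIntegrable_of_Icc zero_le_one),
        isWeakDeriv_iff.mp ((isWeakDeriv_congr_ae hc.2 .rfl).mp h) φ hφ,
        isWeakDeriv_iff.mp (isWeakDeriv_add_integral hw 0) φ hφ, sub_self]
  intro ρ hρ
  have hρ' := hconst hρ
  simp only [Pi.sub_apply, zero_add, intervalIntegral.integral_same, sub_zero] at hρ'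
  exact sub_eq_iff_eq_add.mp hρ'

lemma IsWeakDeriv.integral_re_inner_eq (h : IsWeakDeriv z w) (hw : IntegrableOn w (Ioo 0 1))
    (hc : IsContRepr z zc) :
    ∫ ρ in Ioo (0 : ℝ) 1, (⟪z ρ, w ρ⟫_ℂ).re = (‖zc 1‖ ^ 2 - ‖zc 0‖ ^ 2) / 2 := by
  have heq := h.eqOn_add_integral hw hc
  rw [heq (right_mem_Icc.mpr zero_le_one), ← integral_re_inner_add_integral
    (intervalIntegrable_of_integrableOn_Ioo zero_le_one hw),
    ← integral_Ioo_eq_intervalIntegral zero_le_one]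
  refine integral_congr_ae ?_
  filter_upwards [hc.2, ae_restrict_mem measurableSet_Ioo] with ρ hρ hmem
  rw [hρ, heq (Ioo_subset_Icc_self hmem)]

end Sobolev

section EnergySpace

variable {H : Type*} [NormedAddCommGroup H] [InnerProductSpace ℂ H] [CompleteSpace H]
variable {U : Type*} [NormedAddCommGroup U]

namespace PosInvOp

variable (A : PosInvOp H)

lemma isPositive_invSqrt : A.invSqrt.IsPositive :=
  (ContinuousLinearMap.nonneg_iff_isPositive _).mp (CFC.sqrt_nonneg A.inv)

lemma incl_eq_invSqrt (x : A.Half) : A.incl x = A.invSqrt (A.sqrtHalf x) :=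
  (A.invSqrt_sqrt x).symm

/-- The inclusion `H_{1/2} → H` as a bounded operator. -/
def inclL : A.Half →L[ℂ] H := A.invSqrt ∘L (A.sqrtIso : A.Half →L[ℂ] H)

lemma inclL_apply (x : A.Half) : A.inclL x = A.incl x := (A.incl_eq_invSqrt x).symm

lemma inv_op (x : A.op.domain) : A.inv (A.op x) = x :=
  congrArg Subtype.val (A.equiv.symm_apply_apply x)

lemma inv_mem_domain (x : H) : A.inv x ∈ A.op.domain := (A.equiv.symm x).2

lemma op_inv (x : H) : A.op ⟨A.inv x, A.inv_mem_domain x⟩ = x := A.equiv.apply_symm_apply x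

lemma sqrtHalf_eq_invSqrt_op {x : A.Half} (h : A.incl x ∈ A.op.domain) :
    A.sqrtHalf x = A.invSqrt (A.op ⟨A.incl x, h⟩) := by
  apply A.invSqrt_injective
  rw [invSqrt_invSqrt, inv_op, ← incl_eq_invSqrt]

lemma inner_half_eq_inner_op {x y : A.Half} (h : A.incl x ∈ A.op.domain) :
    ⟪x, y⟫_ℂ = ⟪A.op ⟨A.incl x, h⟩, A.incl y⟫_ℂ := by
  change ⟪A.sqrtHalf x, A.sqrtHalf y⟫_ℂ = _
  rw [A.sqrtHalf_eq_invSqrt_op h, A.incl_eq_invSqrt y]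
  exact A.isPositive_invSqrt.isSymmetric _ _

end PosInvOp

section L2

variable {ξ : ℝ}

lemma L2.ae_eq_toLp (hξ : 0 < ξ) {f : ℝ → U} (hf : MemLp f 2 (ENNReal.ofReal ξ •
    (volume : Measure ℝ).restrict (Ioo 0 1))) :
    (hf.toLp f : L2 U ξ) =ᵐ[volume.restrict (Ioo 0 1)] f :=
  (absCont hξ).ae_le hf.coeFn_toLp

lemma memLp_of_continuousOn {f : ℝ → U} (hf : ContinuousOn f (Icc 0 1)) :
    MemLp f 2 (ENNReal.ofReal ξ • (volume : Measure ℝ).restrict (Ioo 0 1)) := by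
  obtain ⟨C, hC⟩ := isCompact_Icc.exists_bound_of_continuousOn hf
  refine MemLp.smul_measure ?_ ENNReal.ofReal_ne_top
  refine MemLp.of_bound ((hf.mono Ioo_subset_Icc_self).aestronglyMeasurable measurableSet_Ioo) C ?_
  filter_upwards [ae_restrict_mem measurableSet_Ioo] with ρ hρ
  exact hC ρ (Ioo_subset_Icc_self hρ)

lemma L2.coe_smul_ae [InnerProductSpace ℂ U] (hξ : 0 < ξ) (r : ℝ) (z : L2 U ξ) :
    (r • z : L2 U ξ) =ᵐ[volume.restrict (Ioo 0 1)] fun ρ => r • z ρ :=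
  (absCont hξ).ae_le (Lp.coeFn_smul r z)

lemma L2.coe_sub_ae (hξ : 0 < ξ) (z w : L2 U ξ) :
    (z - w : L2 U ξ) =ᵐ[volume.restrict (Ioo 0 1)] fun ρ => z ρ - w ρ :=
  (absCont hξ).ae_le (Lp.coeFn_sub z w)

lemma L2.re_inner_eq [InnerProductSpace ℂ U] (hξ : 0 < ξ) (z w : L2 U ξ) :
    (⟪z, w⟫_ℂ).re = ξ * ∫ ρ in Ioo (0 : ℝ) 1, (⟪z ρ, w ρ⟫_ℂ).re := by
  have hint : Integrable (fun ρ => ⟪z ρ, w ρ⟫_ℂ) (volume.restrict (Ioo 0 1)) := by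
    have hweighted := MeasureTheory.L2.integrable_inner (𝕜 := ℂ) z w
    rwa [integrable_smul_measure (by simpa using hξ) (by simp)] at hweighted
  rw [MeasureTheory.L2.inner_def, integral_smul_measure, ENNReal.toReal_ofReal hξ.le,
    Complex.smul_re, smul_eq_mul]
  exact congrArg (ξ * ·) (integral_re hint).symm

end L2

namespace Hg

variable [InnerProductSpace ℂ U] {A : PosInvOp H} {ξ : ℝ}

lemma inner_eq (X Y : Hg A U ξ) :
    ⟪X, Y⟫_ℂ = ⟪X.u, Y.u⟫_ℂ + (⟪X.v, Y.v⟫_ℂ + ⟪X.z, Y.z⟫_ℂ) := by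
  rw [WithLp.prod_inner_apply, WithLp.prod_inner_apply]
  rfl

lemma norm_v_le (X : Hg A U ξ) : ‖X.v‖ ≤ ‖X‖ :=
  (WithLp.norm_fst_le _ X.snd).trans (WithLp.norm_snd_le _ X)

/-- The component `u` as a bounded operator. -/
def uL : Hg A U ξ →L[ℂ] A.Half := WithLp.fstL 2 ℂ _ _

/-- The component `v` as a bounded operator. -/
def vL : Hg A U ξ →L[ℂ] H := WithLp.fstL 2 ℂ _ _ ∘L WithLp.sndL 2 ℂ _ _

/-- The component `z` as a bounded operator. -/
def zL : Hg A U ξ →L[ℂ] L2 U ξ := WithLp.sndL 2 ℂ _ _ ∘L WithLp.sndL 2 ℂ _ _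

end Hg

end EnergySpace

section Transport

lemma IsContRepr.eqOn {U : Type*} [NormedAddCommGroup U] {z c c' : ℝ → U}
    (hc : IsContRepr z c) (hc' : IsContRepr z c') :
    EqOn c c' (Icc 0 1) := by
  refine Measure.eqOn_Icc_of_ae_eq volume zero_ne_one ?_ hc.1 hc'.1
  rw [← restrict_Ioo_eq_restrict_Icc]
  exact hc.2.symm.trans hc'.2

variable {U : Type*} [NormedAddCommGroup U] [InnerProductSpace ℂ U] {T₀ ξ : ℝ}

/-- `z ∈ H¹(0,1;U)` with `y = -T₀⁻¹ z_ρ`, inflow trace `z(0) = b` and outflow trace `z(1) = a`.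
This isolates the part of `A_g` that acts on the history variable. -/
def TransportRel (T₀ : ℝ) (z y : L2 U ξ) (b a : U) : Prop :=
  ∃ (w : L2 U ξ) (zc : ℝ → U), IsWeakDeriv z w ∧ IsContRepr z zc ∧ zc 0 = b ∧ zc 1 = a ∧
    y = -(T₀⁻¹ • w)

namespace TransportRel

variable {z y z' y' : L2 U ξ} {b a b' a' : U}

lemma eq_traces (h : TransportRel T₀ z y b a) {c : ℝ → U} (hc : IsContRepr z c) :
    b = c 0 ∧ a = c 1 := by
  obtain ⟨w, zc, -, hzc, rfl, rfl, -⟩ := h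
  have heq := hzc.eqOn hc
  exact ⟨heq (left_mem_Icc.mpr zero_le_one), heq (right_mem_Icc.mpr zero_le_one)⟩

variable [CompleteSpace U]

lemma sub (hξ : 0 < ξ) (h : TransportRel T₀ z y b a) (h' : TransportRel T₀ z' y' b' a') :
    TransportRel T₀ (z - z') (y - y') (b - b') (a - a') := by
  obtain ⟨w, c, hw, hc, rfl, rfl, rfl⟩ := h
  obtain ⟨w', c', hw', hc', rfl, rfl, rfl⟩ := h'
  have hsub : ∀ f g : L2 U ξ, (f - g : L2 U ξ) =ᵐ[volume.restrict (Ioo 0 1)]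
      fun ρ => (1 : ℂ) • f ρ + (-1 : ℂ) • g ρ := fun f g => by
    simpa only [one_smul, neg_one_smul, ← sub_eq_add_neg] using L2.coe_sub_ae hξ f g
  refine ⟨w - w', _, hw.lin 1 (-1) (L2.integrableOn hξ _) (L2.integrableOn hξ _)
    (L2.integrableOn hξ _) (L2.integrableOn hξ _) hw' (hsub _ _) (hsub _ _),
    hc.lin 1 (-1) hc' (hsub _ _), ?_, ?_, ?_⟩ <;> module

lemma re_inner_eq (hξ : 0 < ξ) (h : TransportRel T₀ z y b a) :
    (⟪z, y⟫_ℂ).re = ξ / (2 * T₀) * (‖b‖ ^ 2 - ‖a‖ ^ 2) := by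
  obtain ⟨w, zc, hw, hc, rfl, rfl, rfl⟩ := h
  rw [inner_neg_right, inner_smul_right_eq_smul, Complex.neg_re, Complex.smul_re,
    L2.re_inner_eq hξ, hw.integral_re_inner_eq (L2.integrableOn hξ w) hc, smul_eq_mul]
  ring

lemma of_ae_hasDerivAt (hξ : 0 < ξ) (hT₀ : T₀ ≠ 0) {zc : ℝ → U}
    (hac : AbsolutelyContinuousOnInterval zc 0 1) (hz : z =ᵐ[volume.restrict (Ioo 0 1)] zc)
    (hderiv : ∀ᵐ ρ ∂volume.restrict (Ioo 0 1), HasDerivAt zc (-(T₀ • y ρ)) ρ) :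
    TransportRel T₀ z y (zc 0) (zc 1) := by
  have hcont : ContinuousOn zc (Icc 0 1) := by
    simpa only [uIcc_of_le zero_le_one] using hac.continuousOn
  have hw : ((-T₀) • y : L2 U ξ) =ᵐ[volume.restrict (Ioo 0 1)] fun ρ => -(T₀ • y ρ) := by
    simpa only [neg_smul] using L2.coe_smul_ae hξ (-T₀) y
  have hderiv_Icc : ∀ᵐ ρ, ρ ∈ uIcc (0 : ℝ) 1 → HasDerivAt zc (-(T₀ • y ρ)) ρ := by
    rw [uIcc_of_le zero_le_one, ← ae_restrict_iff' measurableSet_Icc,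
      ← restrict_Ioo_eq_restrict_Icc]
    exact hderiv
  refine ⟨(-T₀) • y, zc, (isWeakDeriv_congr_ae hz hw).mpr (isWeakDeriv_of_ae_hasDerivAt hac
    hderiv_Icc ((L2.integrableOn hξ y).smul T₀).neg), ⟨hcont, hz⟩, rfl, rfl, ?_⟩
  rw [neg_smul, smul_neg, neg_neg, inv_smul_smul₀ hT₀]

end TransportRel

lemma hasDerivAt_exp_neg_mul_smul {F : ℝ → U} {f : U} {ρ : ℝ} (k : ℝ)
    (hF : HasDerivAt F (Real.exp (k * ρ) • f) ρ) :
    HasDerivAt (fun ρ => Real.exp (-(k * ρ)) • F ρ) (f - k • Real.exp (-(k * ρ)) • F ρ) ρ := by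
  have hexp : HasDerivAt (fun ρ => Real.exp (-(k * ρ))) (Real.exp (-(k * ρ)) * -k) ρ :=
    (((hasDerivAt_id ρ).const_mul k).neg.congr_deriv (by simp)).exp
  refine (hexp.smul hF).congr_deriv ?_
  rw [smul_smul, ← Real.exp_add, neg_add_cancel, Real.exp_zero]
  module

variable [CompleteSpace U]

lemma exists_transportRel_resolvent (hξ : 0 < ξ) (hT₀ : T₀ ≠ 0) (l : ℝ) (h : L2 U ξ) :
    ∃ p : U, ∀ b : U, ∃ z : L2 U ξ,
      TransportRel T₀ z (l • z - h) b (Real.exp (-(l * T₀)) • (b + p)) := by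
  set k := l * T₀
  have hg : IntervalIntegrable (fun ρ => Real.exp (k * ρ) • T₀ • h ρ) volume 0 1 :=
    (intervalIntegrable_of_integrableOn_Ioo zero_le_one
      ((L2.integrableOn hξ h).smul T₀)).continuousOn_smul (by fun_prop)
  refine ⟨∫ s in (0 : ℝ)..1, Real.exp (k * s) • T₀ • h s, fun b => ?_⟩
  set zc : ℝ → U := fun ρ =>
    Real.exp (-(k * ρ)) • (b + ∫ s in (0 : ℝ)..ρ, Real.exp (k * s) • T₀ • h s) with hzc
  have hexp : ContDiffOn ℝ 1 (fun ρ : ℝ => Real.exp (-(k * ρ))) (uIcc 0 1) := by fun_prop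
  have hac : AbsolutelyContinuousOnInterval zc 0 1 :=
    hexp.absolutelyContinuousOnInterval.smul
      (absolutelyContinuousOnInterval_add_integral hg b)
  have hmem : MemLp zc 2 (ENNReal.ofReal ξ • (volume : Measure ℝ).restrict (Ioo 0 1)) :=
    memLp_of_continuousOn (by simpa only [uIcc_of_le zero_le_one] using hac.continuousOn)
  have hz := L2.ae_eq_toLp hξ hmem
  refine ⟨hmem.toLp zc, ?_⟩
  convert! TransportRel.of_ae_hasDerivAt hξ hT₀ hac hz ?_ using 1
  · simp [hzc]
  · simp [hzc]
  · filter_upwards [hz, L2.coe_sub_ae hξ (l • hmem.toLp zc) h, L2.coe_smul_ae hξ l (hmem.toLp zc),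
      ae_restrict_mem measurableSet_Ioo, ae_restrict_of_ae (ae_hasDerivAt_add_integral hg b)]
      with ρ hρ hsub hsmul hmem_Ioo hderiv
    refine (hasDerivAt_exp_neg_mul_smul k (hderiv ?_)).congr_deriv ?_
    · exact uIcc_of_le (zero_le_one' ℝ) ▸ Ioo_subset_Icc_self hmem_Ioo
    · rw [hsub, hsmul, hρ]
      simp only [hzc, k]
      module

end Transport

section Generator

variable {H : Type*} [NormedAddCommGroup H] [InnerProductSpace ℂ H] [CompleteSpace H]
variable {U : Type*} [NormedAddCommGroup U] [InnerProductSpace ℂ U] [CompleteSpace U]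
variable {A : PosInvOp H} {B : U →L[ℂ] H} {μ T₀ ξ : ℝ}

/-- The constant `c` for which `A_g - c` is dissipative. -/
def growth (B : U →L[ℂ] H) (μ T₀ ξ : ℝ) : ℝ := (|μ| / 2 + ξ / (2 * T₀)) * ‖B.adjoint‖ ^ 2

lemma abs_half_le_div (hT₀ : 0 < T₀) (hμ : |μ| * T₀ ≤ ξ) : |μ| / 2 ≤ ξ / (2 * T₀) := by
  rw [div_le_div_iff₀ two_pos (by positivity)]
  linarith

lemma abs_mul_norm_sq_le_growth (hT₀ : 0 < T₀) (hμ : |μ| * T₀ ≤ ξ) :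
    |μ| * ‖B.adjoint‖ ^ 2 ≤ growth B μ T₀ ξ :=
  mul_le_mul_of_nonneg_right (by linarith [abs_half_le_div hT₀ hμ]) (sq_nonneg _)

namespace GenRel

variable {x y : Hg A U ξ}

lemma iff_transportRel : GenRel A B μ T₀ ξ x y ↔
    ∃ (hu : A.incl x.u ∈ A.op.domain) (a : U), TransportRel T₀ x.z y.z (B.adjoint x.v) a ∧
      A.incl y.u = x.v ∧ y.v = -A.op ⟨A.incl x.u, hu⟩ - μ • B a := by
  constructor
  · rintro ⟨hu, w, zc, hw, hc, hb, hyu, hyv, hyz⟩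
    exact ⟨hu, zc 1, ⟨w, zc, hw, hc, hb, rfl, hyz⟩, hyu, hyv⟩
  · rintro ⟨hu, a, ⟨w, zc, hw, hc, hb, rfl, hyz⟩, hyu, hyv⟩
    exact ⟨hu, w, zc, hw, hc, hb, hyu, hyv, hyz⟩

lemma exists_re_inner_eq (hξ : 0 < ξ) (h : GenRel A B μ T₀ ξ x y) :
    ∃ a : U, (⟪x, y⟫_ℂ).re = -(μ * (⟪B.adjoint x.v, a⟫_ℂ).re) +
      ξ / (2 * T₀) * (‖B.adjoint x.v‖ ^ 2 - ‖a‖ ^ 2) := by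
  obtain ⟨hu, a, hz, hyu, hyv⟩ := iff_transportRel.mp h
  have hwave : (⟪x.v, y.v⟫_ℂ).re =
      -(⟪x.u, y.u⟫_ℂ).re - μ * (⟪B.adjoint x.v, a⟫_ℂ).re := by
    rw [A.inner_half_eq_inner_op hu, hyu, hyv, inner_sub_right, inner_neg_right,
      inner_smul_right_eq_smul, Complex.sub_re, Complex.neg_re, Complex.smul_re, smul_eq_mul,
      ContinuousLinearMap.adjoint_inner_left]
    exact congrArg (-· - _) (inner_re_symm (𝕜 := ℂ) _ _)
  refine ⟨a, ?_⟩
  rw [Hg.inner_eq, Complex.add_re, Complex.add_re, hwave, hz.re_inner_eq hξ]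
  ring

lemma re_inner_le (hT₀ : 0 < T₀) (hξ : 0 < ξ) (hμ : |μ| * T₀ ≤ ξ) (h : GenRel A B μ T₀ ξ x y) :
    (⟪x, y⟫_ℂ).re ≤ growth B μ T₀ ξ * ‖x‖ ^ 2 := by
  obtain ⟨a, hinner⟩ := h.exists_re_inner_eq hξ
  have hB : ‖B.adjoint x.v‖ ^ 2 ≤ ‖B.adjoint‖ ^ 2 * ‖x‖ ^ 2 := by
    rw [← mul_pow]
    gcongr
    exact B.adjoint.le_opNorm_of_le x.norm_v_le
  have hyoung : -(μ * (⟪B.adjoint x.v, a⟫_ℂ).re) ≤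
      |μ| / 2 * (‖B.adjoint x.v‖ ^ 2 + ‖a‖ ^ 2) := calc
    _ ≤ |μ| * |(⟪B.adjoint x.v, a⟫_ℂ).re| := (neg_le_abs _).trans_eq (abs_mul _ _)
    _ ≤ |μ| * (‖B.adjoint x.v‖ * ‖a‖) := by
      gcongr
      exact (Complex.abs_re_le_norm _).trans (norm_inner_le_norm _ _)
    _ ≤ |μ| * ((‖B.adjoint x.v‖ ^ 2 + ‖a‖ ^ 2) / 2) := by
      gcongr
      linarith [two_mul_le_add_sq ‖B.adjoint x.v‖ ‖a‖]
    _ = _ := by ring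
  calc (⟪x, y⟫_ℂ).re
    _ ≤ (|μ| / 2 + ξ / (2 * T₀)) * ‖B.adjoint x.v‖ ^ 2 -
        (ξ / (2 * T₀) - |μ| / 2) * ‖a‖ ^ 2 := by linarith
    _ ≤ (|μ| / 2 + ξ / (2 * T₀)) * ‖B.adjoint x.v‖ ^ 2 :=
      sub_le_self _ (mul_nonneg (sub_nonneg.mpr (abs_half_le_div hT₀ hμ)) (sq_nonneg _))
    _ ≤ (|μ| / 2 + ξ / (2 * T₀)) * (‖B.adjoint‖ ^ 2 * ‖x‖ ^ 2) := by gcongr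
    _ = growth B μ T₀ ξ * ‖x‖ ^ 2 := by rw [growth]; ring

end GenRel

lemma exists_add_apply_eq_of_isPositive {P : H →L[ℂ] H} (hP : P.IsPositive) (r : H) :
    ∃ y, y + P y = r := by
  have hunit : IsUnit (1 + P) := (isStrictlyPositive_one.add_nonneg
    ((ContinuousLinearMap.nonneg_iff_isPositive P).mpr hP)).isUnit
  obtain ⟨Q, hQ⟩ := hunit.exists_right_inv
  exact ⟨Q r, congrArg (fun T : H →L[ℂ] H => T r) hQ⟩

lemma PosInvOp.exists_op_add_eq (A : PosInvOp H) {M : H →L[ℂ] H} (hM : M.IsPositive) (r : H) :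
    ∃ (u : A.Half) (hu : A.incl u ∈ A.op.domain), A.op ⟨A.incl u, hu⟩ + M (A.incl u) = r := by
  -- With `u = A^{-1/2} y` the equation becomes `y + A^{-1/2} M A^{-1/2} y = A^{-1/2} r`.
  have hpos : (A.invSqrt ∘L M ∘L A.invSqrt).IsPositive := by
    simpa only [A.isPositive_invSqrt.isSelfAdjoint.adjoint_eq] using hM.conj_adjoint A.invSqrt
  obtain ⟨y, hy⟩ := exists_add_apply_eq_of_isPositive hpos (A.invSqrt r)
  have hu : A.incl (A.sqrtIso.symm y) = A.invSqrt y := by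
    rw [A.incl_eq_invSqrt]
    exact congrArg A.invSqrt (A.sqrtIso.apply_symm_apply y)
  have hinv : A.incl (A.sqrtIso.symm y) = A.inv (r - M (A.incl (A.sqrtIso.symm y))) := by
    rw [hu, ← A.invSqrt_invSqrt, map_sub]
    exact congrArg A.invSqrt (eq_sub_iff_add_eq.mpr hy)
  refine ⟨A.sqrtIso.symm y, hinv ▸ A.inv_mem_domain _, eq_sub_iff_add_eq.mp ?_⟩
  exact (congrArg A.op (Subtype.ext hinv)).trans (A.op_inv _)

lemma isPositive_smul_one_add_smul_comp_adjoint {m κ : ℝ} (hκ : |κ| * ‖B.adjoint‖ ^ 2 ≤ m) :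
    (m • (1 : H →L[ℂ] H) + κ • (B ∘L B.adjoint)).IsPositive := by
  have hself : IsSelfAdjoint (κ • (B ∘L B.adjoint)) :=
    (IsSelfAdjoint.all κ).smul (ContinuousLinearMap.isPositive_self_comp_adjoint B).isSelfAdjoint
  have hnorm : ‖κ • (B ∘L B.adjoint)‖ ≤ m := by
    have hBB := ContinuousLinearMap.norm_adjoint_comp_self B.adjoint
    rw [ContinuousLinearMap.adjoint_adjoint, ← sq] at hBB
    rwa [norm_smul, hBB, Real.norm_eq_abs]
  rw [← ContinuousLinearMap.nonneg_iff_isPositive, ← neg_le_iff_add_nonneg']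
  refine le_trans ?_ hself.neg_algebraMap_norm_le_self
  rw [Algebra.algebraMap_eq_smul_one, neg_le_neg_iff]
  exact smul_le_smul_of_nonneg_right hnorm zero_le_one

lemma GenRel.exists_resolvent (hT₀ : 0 < T₀) (hξ : 0 < ξ) (hμ : |μ| * T₀ ≤ ξ) {l : ℝ}
    (hl₀ : 0 < l) (hl : growth B μ T₀ ξ ≤ l) (y : Hg A U ξ) :
    ∃ x, GenRel A B μ T₀ ξ x (l • x - y) := by
  obtain ⟨p, hp⟩ := exists_transportRel_resolvent hξ hT₀.ne' l y.z
  set e := Real.exp (-(l * T₀))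
  have he_pos : 0 < e := Real.exp_pos _
  have he_le : e ≤ 1 := Real.exp_le_one_iff.mpr (neg_nonpos.mpr (by positivity))
  have hκ : |l * (μ * e)| * ‖B.adjoint‖ ^ 2 ≤ l ^ 2 := calc
    _ = l * e * (|μ| * ‖B.adjoint‖ ^ 2) := by
      rw [abs_mul, abs_mul, abs_of_pos hl₀, abs_of_pos he_pos]; ring
    _ ≤ l * 1 * l := by
      gcongr
      exact (abs_mul_norm_sq_le_growth hT₀ hμ).trans hl
    _ = l ^ 2 := by ring
  -- Eliminating `v = l u - y.u` and `z(1) = e (B^* v + p)` leaves an equation for `u` alone.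
  obtain ⟨u, hu, hstat⟩ := A.exists_op_add_eq (isPositive_smul_one_add_smul_comp_adjoint hκ)
    (y.v + l • A.incl y.u + (μ * e) • B (B.adjoint (A.incl y.u) - p))
  obtain ⟨z, hz⟩ := hp (B.adjoint (l • A.incl u - A.incl y.u))
  refine ⟨Hg.mk u (l • A.incl u - A.incl y.u) z, GenRel.iff_transportRel.mpr
    ⟨hu, _, hz, A.incl.map_sub _ _ |>.trans ?_, ?_⟩⟩
  · exact congrArg (· - _) (A.incl.map_smul_of_tower l u)
  · change l • (l • A.incl u - A.incl y.u) - y.v = -A.op ⟨A.incl u, hu⟩ - _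
    have hop : A.op ⟨A.incl u, hu⟩ +
        (l ^ 2 • A.incl u + (l * (μ * e)) • B (B.adjoint (A.incl u))) =
      y.v + l • A.incl y.u + (μ * e) • B (B.adjoint (A.incl y.u) - p) := hstat
    rw [eq_sub_of_add_eq hop]
    simp only [map_add, map_sub, ContinuousLinearMap.map_smul_of_tower]
    module

lemma Ag_isMaximalDissipativeShift (hT₀ : 0 < T₀) (hξ : 0 < ξ) (hμ : |μ| * T₀ ≤ ξ) :
    IsMaximalDissipativeShift (Ag A B μ T₀ hξ) (growth B μ T₀ ξ) := by
  refine isMaximalDissipativeShift_of_graph (fun x y h => ?_) fun l hl f => ?_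
  · exact ((mem_Ag_graph hξ).mp h).re_inner_le hT₀ hξ hμ
  · have hgrowth : 0 ≤ growth B μ T₀ ξ := by unfold growth; positivity
    obtain ⟨x, hx⟩ := GenRel.exists_resolvent (B := B) hT₀ hξ hμ (by positivity)
      (le_add_of_nonneg_left hl.le) f
    exact ⟨x, (mem_Ag_graph hξ).mpr hx⟩

end Generator

section DelaySystem

lemma hasDerivWithinAt_clm_apply {E F : Type*} [NormedAddCommGroup E] [NormedSpace ℂ E]
    [NormedAddCommGroup F] [NormedSpace ℂ F] (L : E →L[ℂ] F) {f : ℝ → E} {f' : E}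
    {s : Set ℝ} {t : ℝ} (h : HasDerivWithinAt f f' s t) :
    HasDerivWithinAt (fun t => L (f t)) (L f') s t :=
  (L.restrictScalars ℝ).hasFDerivAt.comp_hasDerivWithinAt t h

variable {H : Type*} [NormedAddCommGroup H] [InnerProductSpace ℂ H] [CompleteSpace H]

lemma wave_eq_zero (A : PosInvOp H) {u v a : ℝ → H} {T : ℝ} (hu₀ : u 0 = 0) (hv₀ : v 0 = 0)
    (hu : ∀ t ∈ Icc 0 T, HasDerivWithinAt u (v t) (Ici 0) t)
    (hv : ∀ t ∈ Icc 0 T, HasDerivWithinAt v (a t) (Ici 0) t)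
    (ha : ∀ t ∈ Icc 0 T, A.inv (a t) = -u t) {t : ℝ} (ht : t ∈ Icc 0 T) :
    u t = 0 ∧ v t = 0 := by
  -- The energy is taken one level below `H_{1/2} × H`, as `v` need not lie in `H_{1/2}`.
  set energy : ℝ → ℝ := fun s => ‖A.invSqrt (v s)‖ ^ 2 + ‖u s‖ ^ 2
  have hderiv : ∀ s ∈ Icc 0 T, HasDerivWithinAt energy 0 (Ici 0) s := fun s hs => by
    have hinner : (⟪A.invSqrt (v s), A.invSqrt (a s)⟫_ℂ).re = -(⟪u s, v s⟫_ℂ).re := by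
      have hsymm : ⟪A.invSqrt (v s), A.invSqrt (a s)⟫_ℂ =
          ⟪v s, A.invSqrt (A.invSqrt (a s))⟫_ℂ := A.isPositive_invSqrt.isSymmetric _ _
      rw [hsymm, A.invSqrt_invSqrt, ha s hs, inner_neg_right, Complex.neg_re]
      exact congrArg Neg.neg (inner_re_symm (𝕜 := ℂ) _ _)
    refine ((hasDerivWithinAt_norm_sq (hasDerivWithinAt_clm_apply A.invSqrt (hv s hs))).add
      (hasDerivWithinAt_norm_sq (hu s hs))).congr_deriv ?_
    rw [hinner]
    ring
  have hconst : energy t = energy 0 := constant_of_has_deriv_right_zero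
    (fun s hs => (hderiv s hs).continuousWithinAt.mono Icc_subset_Ici_self)
    (fun s hs => (hderiv s (Ico_subset_Icc_self hs)).mono (Ici_subset_Ici.mpr hs.1)) t ht
  have hzero : ‖A.invSqrt (v t)‖ ^ 2 + ‖u t‖ ^ 2 = 0 := by
    simpa [energy, hu₀, hv₀] using hconst
  obtain ⟨hvt, hut⟩ := (add_eq_zero_iff_of_nonneg (sq_nonneg _) (sq_nonneg _)).mp hzero
  exact ⟨by simpa using hut, A.invSqrt_injective (by simpa using hvt)⟩

variable {U : Type*} [NormedAddCommGroup U] [InnerProductSpace ℂ U] [CompleteSpace U]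
variable {A : PosInvOp H} {B : U →L[ℂ] H} {μ T₀ : ℝ} {u₀ u₁ : H} {u v u' v' : ℝ → H}

namespace IsDelaySolution

lemma exists_acceleration (h : IsDelaySolution A B μ T₀ u₀ u₁ u v) :
    ∃ a : ℝ → H, (∀ t, 0 ≤ t → HasDerivWithinAt v (a t) (Ici 0) t) ∧
      (∀ t, 0 ≤ t → t ≤ T₀ → A.inv (a t) = -u t) ∧
      ∀ t, 0 ≤ t → T₀ ≤ t → A.inv (a t + μ • B (B.adjoint (v (t - T₀)))) = -u t := by
  obtain ⟨-, -, -, a, -, ha, heq⟩ := h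
  refine ⟨a, ha, fun t ht hle => ?_, fun t ht hle => ?_⟩ <;>
    obtain ⟨hD, hbefore, hafter⟩ := heq t ht
  · rw [eq_neg_of_add_eq_zero_left (hbefore hle), map_neg, A.inv_op]
  · rw [eq_neg_of_add_eq_zero_left ((add_right_comm _ _ _).trans (hafter hle)), map_neg, A.inv_op]

lemma eqOn_Icc_add (h : IsDelaySolution A B μ T₀ u₀ u₁ u v)
    (h' : IsDelaySolution A B μ T₀ u₀ u₁ u' v') {T : ℝ} (hv : EqOn v v' (Icc 0 T)) :
    EqOn u u' (Icc 0 (T + T₀)) ∧ EqOn v v' (Icc 0 (T + T₀)) := by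
  obtain ⟨a, ha, hbefore, hafter⟩ := h.exists_acceleration
  obtain ⟨a', ha', hbefore', hafter'⟩ := h'.exists_acceleration
  obtain ⟨hu₀, hv₀, hu, -⟩ := h
  obtain ⟨hu₀', hv₀', hu', -⟩ := h'
  have hwave : ∀ t ∈ Icc 0 (T + T₀), A.inv (a t - a' t) = -(u t - u' t) := by
    intro t ht
    rw [neg_sub']
    rcases le_total t T₀ with hle | hle
    · rw [← hbefore t ht.1 hle, ← hbefore' t ht.1 hle, map_sub]
    · rw [← hafter t ht.1 hle, ← hafter' t ht.1 hle, ← map_sub,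
        hv ⟨sub_nonneg.mpr hle, sub_le_iff_le_add.mpr ht.2⟩, add_sub_add_right_eq_sub]
  have hzero : ∀ t ∈ Icc 0 (T + T₀), u t - u' t = 0 ∧ v t - v' t = 0 := fun t ht =>
    wave_eq_zero A (u := fun t => u t - u' t) (v := fun t => v t - v' t)
      (by rw [hu₀, hu₀', sub_self]) (by rw [hv₀, hv₀', sub_self])
      (fun s hs => (hu s hs.1).sub (hu' s hs.1)) (fun s hs => (ha s hs.1).sub (ha' s hs.1))
      hwave ht
  exact ⟨fun t ht => sub_eq_zero.mp (hzero t ht).1, fun t ht => sub_eq_zero.mp (hzero t ht).2⟩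

theorem eqOn (hT₀ : 0 < T₀) (h : IsDelaySolution A B μ T₀ u₀ u₁ u v)
    (h' : IsDelaySolution A B μ T₀ u₀ u₁ u' v') : EqOn u u' (Ici 0) := by
  have hvelocity : ∀ n : ℕ, EqOn v v' (Icc 0 (n * T₀)) := fun n => by
    induction n with
    | zero =>
      rw [Nat.cast_zero, zero_mul, Icc_self, eqOn_singleton, h.2.1, h'.2.1]
    | succ n ih =>
      rw [Nat.cast_succ, add_one_mul]
      exact (h.eqOn_Icc_add h' ih).2
  intro t ht
  obtain ⟨n, hn⟩ := exists_nat_ge (t / T₀)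
  exact (h.eqOn_Icc_add h' (hvelocity n)).1
    ⟨ht, ((div_le_iff₀ hT₀).mp hn).trans (le_add_of_nonneg_right hT₀.le)⟩

end IsDelaySolution

end DelaySystem

section History

lemma eq_zero_of_re_inner_integral_nonpos {E : Type*} [NormedAddCommGroup E]
    [InnerProductSpace ℂ E] [CompleteSpace E] {f : ℝ → E} (hf : ContinuousOn f (Ici 0))
    (h : ∀ t, 0 ≤ t → (⟪∫ s in (0 : ℝ)..t, f s, f t⟫_ℂ).re ≤ 0) {t : ℝ} (ht : 0 ≤ t) :
    f t = 0 := by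
  have hint : ∀ s ∈ Ici (0 : ℝ), ∫ r in (0 : ℝ)..s, f r = 0 := fun s hs => by
    simpa using norm_le_exp_mul_of_re_inner_deriv_le (c := 0)
      (fun r hr => hasDerivWithinAt_integral_Ici hf hr) (fun r hr => by simpa using h r hr) hs
  exact (uniqueDiffOn_Ici 0 t ht).eq_deriv _ (hasDerivWithinAt_integral_Ici hf ht)
    ((hasDerivWithinAt_const t (Ici 0) 0).congr hint (hint t ht))

variable {H : Type*} [NormedAddCommGroup H] [InnerProductSpace ℂ H] [CompleteSpace H]
variable {U : Type*} [NormedAddCommGroup U] [InnerProductSpace ℂ U]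
variable {A : PosInvOp H} {B : U →L[ℂ] H} {μ T₀ ξ : ℝ}

instance isFiniteMeasure_weighted (ξ : ℝ) :
    IsFiniteMeasure (ENNReal.ofReal ξ • (volume : Measure ℝ).restrict (Ioo 0 1)) :=
  Measure.smul_finite _ ENNReal.ofReal_ne_top

/-- The embedding of `C([0,1];U)` into `L²(0,1;U)`. -/
def contToL2 (ξ : ℝ) : C(Icc (0 : ℝ) 1, U) →L[ℂ] L2 U ξ :=
  BoundedContinuousFunction.toLp 2 _ ℂ ∘L
    LinearMap.mkContinuous
      { toFun := fun f => (BoundedContinuousFunction.mkOfCompact f).compContinuous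
          ⟨projIcc 0 1 zero_le_one, continuous_projIcc⟩
        map_add' := fun _ _ => rfl
        map_smul' := fun _ _ => rfl } 1 fun f => by
      rw [one_mul, BoundedContinuousFunction.norm_le (norm_nonneg f)]
      exact fun x => f.norm_coe_le_norm _

lemma contToL2_ae (hξ : 0 < ξ) (f : C(Icc (0 : ℝ) 1, U)) :
    contToL2 ξ f =ᵐ[volume.restrict (Ioo 0 1)] fun ρ => f (projIcc 0 1 zero_le_one ρ) :=
  (absCont hξ).ae_le (BoundedContinuousFunction.coeFn_toLp 2 _ ℂ _)

/-- The history `ρ ↦ φ (t - T₀ ρ)` of `φ` at time `t`, as a continuous function of `t`. -/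
def delayed (T₀ : ℝ) (φ : C(ℝ, U)) : C(ℝ, C(Icc (0 : ℝ) 1, U)) :=
  ContinuousMap.curry ⟨fun p : ℝ × Icc (0 : ℝ) 1 => φ (p.1 - T₀ * p.2), by fun_prop⟩

lemma contToL2_delayed_ae (hξ : 0 < ξ) (T₀ : ℝ) (φ : C(ℝ, U)) (t : ℝ) :
    contToL2 ξ (delayed T₀ φ t) =ᵐ[volume.restrict (Ioo 0 1)] fun ρ => φ (t - T₀ * ρ) := by
  filter_upwards [contToL2_ae hξ (delayed T₀ φ t), ae_restrict_mem measurableSet_Ioo] with ρ hae hρ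
  rw [hae, projIcc_of_mem _ (Ioo_subset_Icc_self hρ)]
  rfl

lemma isContRepr_contToL2_delayed (hξ : 0 < ξ) (T₀ : ℝ) (φ : C(ℝ, U)) (t : ℝ) :
    IsContRepr (contToL2 ξ (delayed T₀ φ t)) fun ρ => φ (t - T₀ * ρ) :=
  ⟨Continuous.continuousOn (by fun_prop), contToL2_delayed_ae hξ T₀ φ t⟩

variable [CompleteSpace U]

lemma integral_delayed_apply (hT₀ : 0 ≤ T₀) {φ : C(ℝ, U)} (hφ : ∀ s ≤ 0, φ s = 0) (t : ℝ)
    (ρ : Icc (0 : ℝ) 1) :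
    (∫ s in (0 : ℝ)..t, delayed T₀ φ s) ρ = ∫ s in (0 : ℝ)..(t - T₀ * ρ), φ s := by
  have hpast : ∫ s in (0 - T₀ * ρ)..0, φ s = 0 := by
    rw [intervalIntegral.integral_congr (g := fun _ => (0 : U)), intervalIntegral.integral_zero]
    intro s hs
    rw [uIcc_of_le (by linarith [mul_nonneg hT₀ ρ.2.1])] at hs
    exact hφ s hs.2
  calc (∫ s in (0 : ℝ)..t, delayed T₀ φ s) ρ = ∫ s in (0 : ℝ)..t, φ (s - T₀ * ρ) :=
        ((ContinuousMap.evalCLM ℝ ρ).intervalIntegral_comp_comm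
          ((delayed T₀ φ).continuous.intervalIntegrable 0 t)).symm
    _ = ∫ s in (0 - T₀ * ρ)..(t - T₀ * ρ), φ s := intervalIntegral.integral_comp_sub_right ..
    _ = ∫ s in (0 : ℝ)..(t - T₀ * ρ), φ s := by
      rw [← intervalIntegral.integral_add_adjacent_intervals
        (φ.continuous.intervalIntegrable _ 0) (φ.continuous.intervalIntegrable 0 _), hpast,
        zero_add]

lemma transportRel_delayed (hξ : 0 < ξ) (hT₀ : 0 < T₀) {φ : C(ℝ, U)} (hφ : ∀ s ≤ 0, φ s = 0)
    (t : ℝ) :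
    TransportRel T₀ (contToL2 ξ (∫ s in (0 : ℝ)..t, delayed T₀ φ s))
      (contToL2 ξ (delayed T₀ φ t)) (∫ s in (0 : ℝ)..t, φ s) (∫ s in (0 : ℝ)..(t - T₀), φ s) := by
  set zc : ℝ → U := fun ρ => ∫ s in (0 : ℝ)..(t - T₀ * ρ), φ s
  have hderiv : ∀ ρ, HasDerivAt zc (-(T₀ • φ (t - T₀ * ρ))) ρ := fun ρ => by
    have hlin : HasDerivAt (fun ρ : ℝ => t - T₀ * ρ) (-T₀) ρ := by
      simpa using ((hasDerivAt_id ρ).const_mul T₀).const_sub t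
    rw [← neg_smul]
    exact (φ.continuous.integral_hasStrictDerivAt 0 _).hasDerivAt.scomp ρ hlin
  have hC1 : ContDiff ℝ 1 zc := by
    rw [contDiff_one_iff_deriv, funext fun ρ => (hderiv ρ).deriv]
    exact ⟨fun ρ => (hderiv ρ).differentiableAt, by fun_prop⟩
  have hz : contToL2 ξ (∫ s in (0 : ℝ)..t, delayed T₀ φ s) =ᵐ[volume.restrict (Ioo 0 1)] zc := by
    filter_upwards [contToL2_ae hξ (∫ s in (0 : ℝ)..t, delayed T₀ φ s),
      ae_restrict_mem measurableSet_Ioo] with ρ hae hρ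
    rw [hae, integral_delayed_apply hT₀.le hφ, projIcc_of_mem _ (Ioo_subset_Icc_self hρ)]
  have hrel := TransportRel.of_ae_hasDerivAt (y := contToL2 ξ (delayed T₀ φ t)) hξ hT₀.ne'
    hC1.contDiffOn.absolutelyContinuousOnInterval hz (by
      filter_upwards [contToL2_delayed_ae hξ T₀ φ t] with ρ hρ
      rw [hρ]
      exact hderiv ρ)
  simpa only [zc, mul_zero, sub_zero, mul_one] using hrel

lemma TransportRel.re_inner_sub_nonpos (hξ : 0 < ξ) (hT₀ : 0 < T₀) {z y z' y' : L2 U ξ}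
    {b a a' : U} (h : TransportRel T₀ z y b a) (h' : TransportRel T₀ z' y' b a') :
    (⟪z - z', y - y'⟫_ℂ).re ≤ 0 := by
  rw [(h.sub hξ h').re_inner_eq hξ, sub_self, norm_zero, zero_pow two_ne_zero, zero_sub]
  exact mul_nonpos_of_nonneg_of_nonpos (by positivity) (neg_nonpos.mpr (sq_nonneg _))

lemma GenRel.adjoint_v_eq_zero (hξ : 0 < ξ) {x y : Hg A U ξ} (h : GenRel A B μ T₀ ξ x y)
    (hz : x.z = 0) : B.adjoint x.v = 0 := by
  obtain ⟨-, a, htransport, -⟩ := GenRel.iff_transportRel.mp h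
  rw [hz] at htransport
  exact (htransport.eq_traces (c := 0)
    ⟨continuousOn_const, (absCont hξ).ae_le (Lp.coeFn_zero _ _ _)⟩).1

lemma IsMildSolution.z_eq_delayed (hξ : 0 < ξ) (hT₀ : 0 < T₀) {x₀ : Hg A U ξ}
    {X : ℝ → Hg A U ξ} (hX : IsMildSolution (Ag A B μ T₀ hξ) x₀ X) (hx₀ : x₀.z = 0)
    {φ : C(ℝ, U)} (hφ₀ : ∀ s ≤ 0, φ s = 0) (hφ : ∀ s, 0 ≤ s → φ s = B.adjoint (X s).v) {t : ℝ}
    (ht : 0 ≤ t) : (X t).z = contToL2 ξ (delayed T₀ φ t) := by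
  rw [isMildSolution_iff_mem_graph] at hX
  obtain ⟨hXcont, hXgraph⟩ := hX
  have hz : ContinuousOn (fun s => Hg.zL (X s)) (Ici 0) :=
    (Hg.zL : Hg A U ξ →L[ℂ] L2 U ξ).continuous.comp_continuousOn hXcont
  have hdelayed : Continuous fun s => contToL2 ξ (delayed T₀ φ s) := by fun_prop
  have hnonpos : ∀ s, 0 ≤ s →
      (⟪∫ r in (0 : ℝ)..s, (Hg.zL (X r) - contToL2 ξ (delayed T₀ φ r)),
        Hg.zL (X s) - contToL2 ξ (delayed T₀ φ s)⟫_ℂ).re ≤ 0 := fun s hs => by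
    have hXint := intervalIntegrable_of_continuousOn_Ici hXcont le_rfl hs
    have hinflow : B.adjoint (∫ r in (0 : ℝ)..s, X r).v = ∫ r in (0 : ℝ)..s, φ r := by
      refine ((B.adjoint ∘L Hg.vL).intervalIntegral_comp_comm hXint).symm.trans
        (intervalIntegral.integral_congr fun r hr => ?_)
      rw [uIcc_of_le hs] at hr
      exact (hφ r hr.1).symm
    have hz_sub : (X s - x₀).z = Hg.zL (X s) :=
      (map_sub Hg.zL (X s) x₀).trans (sub_eq_self.mpr hx₀)
    have hrel : GenRel A B μ T₀ ξ (∫ r in (0 : ℝ)..s, X r) (X s - x₀) :=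
      (mem_Ag_graph hξ).mp (hXgraph s hs)
    obtain ⟨-, a, htransport, -⟩ := GenRel.iff_transportRel.mp hrel
    rw [hinflow, hz_sub] at htransport
    rw [intervalIntegral.integral_sub (intervalIntegrable_of_continuousOn_Ici hz le_rfl hs)
      (hdelayed.intervalIntegrable 0 s), Hg.zL.intervalIntegral_comp_comm hXint,
      (contToL2 ξ).intervalIntegral_comp_comm ((delayed T₀ φ).continuous.intervalIntegrable 0 s)]
    exact htransport.re_inner_sub_nonpos hξ hT₀ (transportRel_delayed hξ hT₀ hφ₀ s)
  exact sub_eq_zero.mp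
    (eq_zero_of_re_inner_integral_nonpos (hz.sub hdelayed.continuousOn) hnonpos ht)

lemma exists_velocity_history {X : ℝ → Hg A U ξ} (hX : ContinuousOn X (Ici 0))
    (h₀ : B.adjoint (X 0).v = 0) :
    ∃ φ : C(ℝ, U), (∀ s ≤ 0, φ s = 0) ∧ ∀ s, 0 ≤ s → φ s = B.adjoint (X s).v := by
  have hcont : Continuous fun s => B.adjoint (X (max s 0)).v :=
    (B.adjoint ∘L Hg.vL).continuous.comp
      (hX.comp_continuous (by fun_prop) fun s => le_max_right s 0)
  refine ⟨⟨_, hcont⟩, fun s hs => ?_, fun s hs => ?_⟩ <;> rw [ContinuousMap.coe_mk]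
  · rw [max_eq_right hs, h₀]
  · rw [max_eq_left hs]

lemma GenRel.acceleration_eq (hξ : 0 < ξ) {x y : Hg A U ξ} (h : GenRel A B μ T₀ ξ x y)
    {φ : C(ℝ, U)} {t : ℝ} (hz : x.z = contToL2 ξ (delayed T₀ φ t)) :
    ∃ hu : A.incl x.u ∈ A.op.domain,
      y.v + A.op ⟨A.incl x.u, hu⟩ + μ • B (φ (t - T₀)) = 0 := by
  obtain ⟨hu, a, htransport, -, hyv⟩ := GenRel.iff_transportRel.mp h
  rw [hz] at htransport
  have ha : a = φ (t - T₀) := by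
    simpa only [mul_one] using
      (htransport.eq_traces (isContRepr_contToL2_delayed hξ T₀ φ t)).2
  refine ⟨hu, ?_⟩
  rw [hyv, ha]
  abel

lemma IsClassicalSolution.isDelaySolution (hξ : 0 < ξ) {x₀ : Hg A U ξ} {X : ℝ → Hg A U ξ}
    (hX : IsClassicalSolution (Ag A B μ T₀ hξ) x₀ X) {φ : C(ℝ, U)} (hφ₀ : ∀ s ≤ 0, φ s = 0)
    (hφ : ∀ s, 0 ≤ s → φ s = B.adjoint (X s).v)
    (hz : ∀ t, 0 ≤ t → (X t).z = contToL2 ξ (delayed T₀ φ t)) :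
    IsDelaySolution A B μ T₀ (A.incl x₀.u) x₀.v (fun t => A.incl (X t).u) (fun t => (X t).v) := by
  obtain ⟨rfl, -, Y, hY, hXY⟩ := hX
  have hrel : ∀ t, 0 ≤ t → GenRel A B μ T₀ ξ (X t) (Y t) := fun t ht =>
    (mem_Ag_graph hξ).mp (mem_graph_iff_exists_mem_domain.mpr (hXY t ht).1)
  refine ⟨rfl, rfl, fun t ht => ?_, fun t => (Y t).v,
    (Hg.vL : Hg A U ξ →L[ℂ] H).continuous.comp_continuousOn hY,
    fun t ht => hasDerivWithinAt_clm_apply Hg.vL (hXY t ht).2, fun t ht => ?_⟩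
  · obtain ⟨-, -, -, hvelocity, -⟩ := GenRel.iff_transportRel.mp (hrel t ht)
    have hderiv := hasDerivWithinAt_clm_apply (A.inclL ∘L Hg.uL) (hXY t ht).2
    simp only [ContinuousLinearMap.comp_apply, A.inclL_apply] at hderiv
    exact hderiv.congr_deriv hvelocity
  · obtain ⟨hu, hacc⟩ := (hrel t ht).acceleration_eq hξ (hz t ht)
    refine ⟨hu, fun hle => ?_, fun hle => ?_⟩
    · rwa [hφ₀ _ (sub_nonpos.mpr hle), map_zero, smul_zero, add_zero] at hacc
    · rwa [hφ _ (sub_nonneg.mpr hle)] at hacc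

end History

end DelayWave

end

theorem mainTheorem2 {H : Type*} [NormedAddCommGroup H] [InnerProductSpace ℂ H] [CompleteSpace H]
    {U : Type*} [NormedAddCommGroup U] [InnerProductSpace ℂ U] [CompleteSpace U]
    (A : DelayWave.PosInvOp H) (B : U →L[ℂ] H) (μ T₀ ξ : ℝ) (hT₀ : 0 < T₀) (hξ : 0 < ξ)
    (hμ : |μ| * T₀ ≤ ξ) :
    DelayWave.IsMaximalDissipativeShift (DelayWave.Ag A B μ T₀ hξ)
      ((|μ| / 2 + ξ / (2 * T₀)) * ‖B.adjoint‖ ^ 2) ∧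
    ∀ (u₀ : A.Half) (u₁ : H), ∃ X : ℝ → DelayWave.Hg A U ξ,
      DelayWave.IsMildSolution (DelayWave.Ag A B μ T₀ hξ) (DelayWave.Hg.mk u₀ u₁ 0) X ∧
      (∀ Y : ℝ → DelayWave.Hg A U ξ,
        DelayWave.IsMildSolution (DelayWave.Ag A B μ T₀ hξ) (DelayWave.Hg.mk u₀ u₁ 0) Y →
          Set.EqOn Y X (Set.Ici 0)) ∧
      (DelayWave.Hg.mk u₀ u₁ 0 ∈ (DelayWave.Ag A B μ T₀ hξ).domain →
        DelayWave.IsClassicalSolution (DelayWave.Ag A B μ T₀ hξ)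
          (DelayWave.Hg.mk u₀ u₁ 0) X ∧
        DelayWave.IsDelaySolution A B μ T₀ (A.incl u₀) u₁
          (fun t => A.incl (X t).u) (fun t => (X t).v) ∧
        (∀ u v : ℝ → H, DelayWave.IsDelaySolution A B μ T₀ (A.incl u₀) u₁ u v →
          Set.EqOn u (fun t => A.incl (X t).u) (Set.Ici 0)) ∧
        ∀ t, 0 ≤ t → ∀ᵐ ρ ∂(MeasureTheory.volume.restrict (Set.Ioo (0 : ℝ) 1)),
          (X t).z ρ = if T₀ * ρ ≤ t then B.adjoint (X (t - T₀ * ρ)).v else 0) := by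
  have hG := DelayWave.Ag_isMaximalDissipativeShift (A := A) (B := B) hT₀ hξ hμ
  refine ⟨hG, fun u₀ u₁ => ?_⟩
  obtain ⟨X, hX⟩ := hG.exists_isMildSolution (DelayWave.Hg.mk u₀ u₁ 0)
  refine ⟨X, hX, fun Y hY => hG.isMildSolution_eqOn hY hX, fun hD => ?_⟩
  have hcl := hG.isClassicalSolution hD hX
  have h₀ : B.adjoint (X 0).v = 0 := by
    rw [hcl.1]
    exact DelayWave.GenRel.adjoint_v_eq_zero hξ
      ((DelayWave.mem_Ag_graph hξ).mp (LinearPMap.mem_graph _ ⟨_, hD⟩)) rfl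
  obtain ⟨φ, hφ₀, hφ⟩ := DelayWave.exists_velocity_history hcl.2.1 h₀
  have hz := fun t ht => hX.z_eq_delayed hξ hT₀ rfl hφ₀ hφ (t := t) ht
  have hdelay := hcl.isDelaySolution hξ hφ₀ hφ hz
  refine ⟨hcl, hdelay, fun u v h => h.eqOn hT₀ hdelay, fun t ht => ?_⟩
  rw [hz t ht]
  filter_upwards [DelayWave.contToL2_delayed_ae hξ T₀ φ t] with ρ hρ
  rw [hρ]
  split_ifs with hle
  · exact hφ _ (sub_nonneg.mpr hle)
  · exact hφ₀ _ (sub_nonpos.mpr (not_le.mp hle).le)
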